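/- **Setting.** Let $p\ge 1$, let $\Upsilon$ be the set of all subsets of $\{1,\dots,p\}$, let $X=(X^1,\dots,X^p)$ be a random vector in $\mathbb R^p$ with independent components and law $\mathbb Q$, and let $Y=f(X)$ with $f:\mathbb R^p\to\mathbb R$ measurable, $\mathbb E[Y^4]<\infty$ and $\mathrm{Var}(Y)>0$. The Sobol' indices are $S^*_u=\frac1{\mathrm{Var}(Y)}\sum_{v\subset u}(-1)^{|u|-|v|}\mathrm{Var}(\mathbb E[Y|X^i,i\in v])$, $u\in\Upsilon$. Let $\Delta_q=\{s\in\mathbb R^\Upsilon: s_u\ge 0,\ s_\emptyset=0,\ \sum_u s_u=1\}$, let $\mathbf M_{u,v}=(-1)^{|u|-|v|}\mathbf 1_{v\subset u}$, whose inverse is $\mathbf M^{-1}_{u,v}=\mathbf 1_{v\subset u}$, and let $a=(a_u)_{u\in\Upsilon}$ be a probability vector on $\Upsilon$. For an independent copy $X'$ of $X$, let $X^{(u)}$ have the coordinates of $X$ in $u$ and those of $X'$ outside $u$, and let $Y^{(u)}=f(X^{(u)})$. Put $$\Phi^a(s)=\frac12\sum_{u\in\Upsilon}a_u\,\mathbb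 E\Big[\big((Y-\mathbb E[Y])[\mathbf M^{-1}s]_u-(Y^{(u)}-\mathbb E[Y])\big)^2\Big],\qquad \min\Phi^a=\min_{s\in\Delta_q}\Phi^a(s),$$ $$\|a\|_{\exp,\ell}=\sum_{u}a_u2^{\ell|u|},\qquad \mathcal D_h(w,v)=h(w)-h(v)-\langle\nabla h(v),w-v\rangle,\qquad h(v)=\sum_u v_u\log v_u .$$ **Algorithm.** Let $(X_n,X_n',U_n)_{n\ge1}$ be i.i.d. with law $\mathbb Q\otimes\mathbb Q\otimes\mathcal L^a$, where $\mathcal L^a(\{u\})=a_u$. Let $Y_n=f(X_n)$, let $Y_n^{(U)}=f(X_n^{(U_n)})$ be built from $(X_n,X_n')$, and let $\widehat m_n=\frac1n\sum_{k=1}^nY_k$. Let $\hat{\mathbf S}_1\in\Delta_q$ have positive coordinates at all $u\ne\emptyset$; it is deterministic or, more generally, a measurable function of $(X_1,X_1',U_1)$ with $\mathbb E[\mathcal D_h(\mathbf S^*,\hat{\mathbf S}_1)]<\infty$. For step sizes $(\eta_j)$ and $n\ge1$, with products and exponentials taken coordinatewise, $$\hat{\mathbf S}_{n+1}=\frac{\hat{\mathbf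 S}_ne^{-\eta_{n+1}g_{n+1}}}{\|\hat{\mathbf S}_ne^{-\eta_{n+1}g_{n+1}}\|_1},\qquad g_{n+1}=(Y_{n+1}-\widehat m_n)\Big[(Y_{n+1}-\widehat m_n)[\mathbf M^{-1}\hat{\mathbf S}_n]_{U_{n+1}}-(Y_{n+1}^{(U)}-\widehat m_n)\Big]\mathbf M^{-1}_{U_{n+1},:}\,,$$ and let $\bar{\mathbf S}^\eta_n=\dfrac{\sum_{k=1}^n\eta_{k+1}\hat{\mathbf S}_k}{\sum_{k=1}^n\eta_{k+1}}$. **Theorem (non-asymptotic risk bound).** (i) There is a universal constant $C>0$ such that in every setting as above and for every horizon $n\ge2$, with $\eta_{k+1}=\dfrac{\mathbf 1_{k\le n-1}}{\sqrt{(1+\sqrt{\|a\|_{\exp,2}})\,n}}$ for $k\ge0$, $$\mathbb E[\Phi^a(\bar{\mathbf S}^\eta_n)]-\min\Phi^a\le\sqrt{1+\sqrt{\|a\|_{\exp,2}}}\,\Big(\mathbb E[\mathcal D_h(\mathbf S^*,\hat{\mathbf S}_1)]+C\,\mathbb E[Y^4]\Big)\frac1{\sqrt n}+5\,\|a\|_{\exp,1/2}\,\mathrm{Var}(Y)\,\frac{\log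 n}{n}.$$ (ii) For every $\eta_0>0$ there is a constant $C>0$ depending only on $\eta_0$ such that in every setting as above, with $\eta_{k+1}=\eta_0(k+1)^{-1/2}$, for every $n\ge2$, $$\mathbb E[\Phi^a(\bar{\mathbf S}^\eta_n)]-\min\Phi^a\le C\Big(\mathbb E[\mathcal D_h(\mathbf S^*,\hat{\mathbf S}_1)]+\|a\|_{\exp,2}+\mathbb E[Y^4]\Big)\frac{\log n}{\sqrt n}.$$ (If $\hat{\mathbf S}_1$ is deterministic, $\mathbb E[\mathcal D_h(\mathbf S^*,\hat{\mathbf S}_1)]=\mathcal D_h(\mathbf S^*,\hat{\mathbf S}_1)$. In both parts the minimum of $\Phi^a$ over $\Delta_q$ is attained and $\Phi^a(\bar{\mathbf S}^\eta_n)$ is integrable.) -/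

import Mathlib

open MeasureTheory ProbabilityTheory

namespace PickFreeze

noncomputable section

/-- Real vectors indexed by the collection `Υ` of all subsets of `{1, …, p}`. -/
abbrev Vec (p : ℕ) : Type := Finset (Fin p) → ℝ

/-! ### The law of the inputs, Sobol indices -/

/-- The law `ℚ` of an input `X = (X^1, …, X^p)` with independent components `X^i ∼ μ i`. -/
def inputLaw {p : ℕ} (μ : Fin p → Measure ℝ) : Measure (Fin p → ℝ) := Measure.pi μ

/-- `E[Y]` for `Y = f(X)`. -/
def meanY {p : ℕ} (μ : Fin p → Measure ℝ) (f : (Fin p → ℝ) → ℝ) : ℝ :=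
  ∫ x, f x ∂(inputLaw μ)

/-- `Var(Y)` for `Y = f(X)`. -/
def varY {p : ℕ} (μ : Fin p → Measure ℝ) (f : (Fin p → ℝ) → ℝ) : ℝ :=
  variance f (inputLaw μ)

/-- `E[Y^4]` for `Y = f(X)`. -/
def fourthMoment {p : ℕ} (μ : Fin p → Measure ℝ) (f : (Fin p → ℝ) → ℝ) : ℝ :=
  ∫ x, f x ^ 4 ∂(inputLaw μ)

/-- The σ-algebra on `ℝ^p` generated by the coordinates `X^i`, `i ∈ v`. -/
abbrev coordSigma {p : ℕ} (v : Finset (Fin p)) : MeasurableSpace (Fin p → ℝ) :=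
  MeasurableSpace.comap (fun (x : Fin p → ℝ) (i : v) => x i) inferInstance

/-- `Var(E[Y | X^i, i ∈ v])`. -/
def closedVar {p : ℕ} (μ : Fin p → Measure ℝ) (f : (Fin p → ℝ) → ℝ) (v : Finset (Fin p)) : ℝ :=
  variance (condExp (coordSigma v) (inputLaw μ) f) (inputLaw μ)

/-- The Sobol indices `S*_u = V_u / Var(Y)`,
`V_u = ∑_{v ⊆ u} (-1)^{|u|-|v|} Var(E[Y | X^i, i ∈ v])`. -/
def sobolIndex {p : ℕ} (μ : Fin p → Measure ℝ) (f : (Fin p → ℝ) → ℝ) : Vec p := fun u =>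
  (∑ v ∈ u.powerset, (-1 : ℝ) ^ (u.card - v.card) * closedVar μ f v) / varY μ f

/-- The matrix `M_{u,v} = (-1)^{|u|-|v|} 1_{v ⊆ u}`, mapping closed Sobol indices to Sobol
indices. -/
def mobius (p : ℕ) : Matrix (Finset (Fin p)) (Finset (Fin p)) ℝ :=
  Matrix.of fun u v => if v ⊆ u then (-1 : ℝ) ^ (u.card - v.card) else 0

/-- `M` is invertible, and `M⁻¹_{u,v} = 1_{v ⊆ u}`. -/
theorem mobius_inv (p : ℕ) :
    (mobius p)⁻¹ = Matrix.of fun u v => if v ⊆ u then (1 : ℝ) else 0 := by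
  apply Matrix.inv_eq_left_inv
  ext u w
  rw [Matrix.mul_apply, Matrix.one_apply]
  simp only [mobius, Matrix.of_apply, ite_mul, one_mul, zero_mul]
  have key : ∑ v, (if v ⊆ u then (if w ⊆ v then (-1 : ℝ) ^ (v.card - w.card) else 0) else 0)
      = if w ⊆ u then ∑ t ∈ (u \ w).powerset, (-1 : ℝ) ^ t.card else 0 := by
    split_ifs with hwu
    · rw [← Finset.sum_filter, ← Finset.sum_filter]
      refine Finset.sum_bij' (fun v _ => v \ w) (fun t _ => t ∪ w) ?_ ?_ ?_ ?_ ?_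
      · intro v hv
        simp only [Finset.mem_filter, Finset.mem_univ, true_and] at hv
        exact Finset.mem_powerset.2 (Finset.sdiff_subset_sdiff hv.1 le_rfl)
      · intro t ht
        rw [Finset.mem_powerset] at ht
        simp only [Finset.mem_filter, Finset.mem_univ, true_and]
        exact ⟨Finset.union_subset (ht.trans Finset.sdiff_subset) hwu,
          Finset.subset_union_right⟩
      · intro v hv
        simp only [Finset.mem_filter, Finset.mem_univ, true_and] at hv
        exact Finset.sdiff_union_of_subset hv.2
      · intro t ht
        rw [Finset.mem_powerset] at ht
        exact Finset.union_sdiff_cancel_right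
          (Finset.disjoint_of_subset_left ht Finset.sdiff_disjoint)
      · intro v hv
        simp only [Finset.mem_filter, Finset.mem_univ, true_and] at hv
        rw [Finset.card_sdiff_of_subset hv.2]
    · refine Finset.sum_eq_zero fun v _ => ?_
      split_ifs with h1 h2
      · exact absurd (h2.trans h1) hwu
      · rfl
      · rfl
  rw [key]
  have h := Finset.sum_powerset_neg_one_pow_card (x := u \ w)
  have h' : ∑ t ∈ (u \ w).powerset, (-1 : ℝ) ^ t.card = if u \ w = ∅ then 1 else 0 := by
    exact_mod_cast h
  rw [h']
  by_cases hwu : w ⊆ u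
  · by_cases huw : u ⊆ w
    · have : u = w := huw.antisymm hwu
      simp [this]
    · have h1 : u ≠ w := fun e => huw (e ▸ le_rfl)
      have h2 : u \ w ≠ ∅ := fun e => huw (Finset.sdiff_eq_empty_iff_subset.1 e)
      simp [h1, h2]
  · have h1 : u ≠ w := fun e => hwu (e ▸ le_rfl)
    simp [h1, hwu]

/-- The simplex `Δ_q` of probability vectors on `Υ` that put no mass on `∅`. -/
def simplex (p : ℕ) : Set (Vec p) :=
  {s | (∀ u, 0 ≤ s u) ∧ s ∅ = 0 ∧ ∑ u, s u = 1}

/-- The elements of `Δ_q` all of whose coordinates at nonempty subsets are positive. -/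
def openSimplex (p : ℕ) : Set (Vec p) :=
  {s | s ∈ simplex p ∧ ∀ u, u ≠ ∅ → 0 < s u}

/-! ### The Pick-Freeze objective function -/

/-- `X^{(u)}`: the coordinates in `u` are those of `x`, the others are those of `x'`. -/
def freeze {p : ℕ} (u : Finset (Fin p)) (x x' : Fin p → ℝ) : Fin p → ℝ :=
  fun i => if i ∈ u then x i else x' i

/-- `ψ_u(θ) = E[((Y - E[Y]) θ - (Y^{(u)} - E[Y]))²]`, where `Y = f(X)`, `Y^{(u)} = f(X^{(u)})`
and `(X, X') ∼ ℚ ⊗ ℚ`. -/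
def psi {p : ℕ} (μ : Fin p → Measure ℝ) (f : (Fin p → ℝ) → ℝ) (u : Finset (Fin p)) (θ : ℝ) : ℝ :=
  ∫ z : (Fin p → ℝ) × (Fin p → ℝ),
    ((f z.1 - meanY μ f) * θ - (f (freeze u z.1 z.2) - meanY μ f)) ^ 2
      ∂((inputLaw μ).prod (inputLaw μ))

/-- `Ψ^a(x) = (1/2) ∑_u a_u ψ_u(x_u)`. -/
def Psi {p : ℕ} (μ : Fin p → Measure ℝ) (f : (Fin p → ℝ) → ℝ) (a : Vec p) (x : Vec p) : ℝ :=
  1 / 2 * ∑ u, a u * psi μ f u (x u)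

/-- `Φ^a(s) = Ψ^a(M⁻¹ s)`. -/
def Phi {p : ℕ} (μ : Fin p → Measure ℝ) (f : (Fin p → ℝ) → ℝ) (a : Vec p) (s : Vec p) : ℝ :=
  Psi μ f a ((mobius p)⁻¹.mulVec s)

/-! ### Entropy and its Bregman divergence -/

/-- The negative entropy `h(v) = ∑_u v_u log v_u`, with `0 log 0 = 0`. -/
def negEntropy {p : ℕ} (v : Vec p) : ℝ := ∑ u, v u * Real.log (v u)

/-- `D_h(w, v) = h(w) - h(v) - ⟨∇h(v), w - v⟩`, where `∇h(v)_u = log v_u + 1`. It is only used for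
`w ∈ Δ_q` and `v` in the open simplex; there the coordinate `∅`, at which both vectors vanish,
contributes `0`. -/
def bregman {p : ℕ} (w v : Vec p) : ℝ :=
  negEntropy w - negEntropy v - ∑ u, (Real.log (v u) + 1) * (w u - v u)

/-! ### The stochastic mirror descent -/

/-- `‖a‖_{exp,ℓ} = ∑_u a_u 2^{ℓ |u|}`. -/
def expNorm {p : ℕ} (a : Vec p) (l : ℝ) : ℝ := ∑ u : Finset (Fin p), a u * (2 : ℝ) ^ (l * u.card)

/-- The law on `Υ` with `P(U = u) = a_u`. -/
def subsetLaw {p : ℕ} (a : Vec p) : Measure (Finset (Fin p)) :=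
  ∑ u, ENNReal.ofReal (a u) • Measure.dirac u

/-- The empirical mean `m̂_n = (1/n) ∑_{k=1}^n Y_k`, `Y_k = f(X_k)`. -/
def empMean {p : ℕ} {Ω : Type*} (f : (Fin p → ℝ) → ℝ) (X : ℕ → Ω → Fin p → ℝ) (n : ℕ) (ω : Ω) :
    ℝ :=
  (∑ k ∈ Finset.Icc 1 n, f (X k ω)) / n

/-- The gradient estimator at step `n + 1`: the vector
`(Y_{n+1} - m̂_n) ((Y_{n+1} - m̂_n) [M⁻¹ s]_U - (Y^{(U)}_{n+1} - m̂_n)) M⁻¹_{U,:}` with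
`U = U_{n+1}`. -/
def gradEst {p : ℕ} {Ω : Type*} (f : (Fin p → ℝ) → ℝ) (X X' : ℕ → Ω → Fin p → ℝ)
    (U : ℕ → Ω → Finset (Fin p)) (n : ℕ) (ω : Ω) (s : Vec p) : Vec p := fun v =>
  (f (X (n + 1) ω) - empMean f X n ω) * (mobius p)⁻¹ (U (n + 1) ω) v *
    ((f (X (n + 1) ω) - empMean f X n ω) * (mobius p)⁻¹.mulVec s (U (n + 1) ω) -
      (f (freeze (U (n + 1) ω) (X (n + 1) ω) (X' (n + 1) ω)) - empMean f X n ω))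

/-- One mirror step `s e^{-η g} / ‖s e^{-η g}‖_1`, coordinate by coordinate. -/
def mirrorStep {p : ℕ} (η : ℝ) (g s : Vec p) : Vec p := fun u =>
  s u * Real.exp (-η * g u) / ∑ v, |s v * Real.exp (-η * g v)|

/-- The iterates `Ŝ_n`, `n ≥ 1`, started from `Ŝ_1 = S₁` and with
`Ŝ_{n+1} = mirrorStep η_{n+1} (gradient estimator at step n + 1) Ŝ_n` for `n ≥ 1`.
The value at `n = 0` is not used. -/
def iterate {p : ℕ} {Ω : Type*} (f : (Fin p → ℝ) → ℝ) (X X' : ℕ → Ω → Fin p → ℝ)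
    (U : ℕ → Ω → Finset (Fin p)) (η : ℕ → ℝ) (S₁ : Ω → Vec p) : ℕ → Ω → Vec p
  | 0 => S₁
  | n + 1 => fun ω =>
      if n = 0 then S₁ ω
      else mirrorStep (η (n + 1)) (gradEst f X X' U n ω (iterate f X X' U η S₁ n ω))
        (iterate f X X' U η S₁ n ω)

/-- The step-weighted Cesàro average `(∑_{k=1}^n η_{k+1} Ŝ_k) / (∑_{k=1}^n η_{k+1})`. -/
def cesaro {p : ℕ} {Ω : Type*} (η : ℕ → ℝ) (S : ℕ → Ω → Vec p) (n : ℕ) (ω : Ω) : Vec p :=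
  (∑ k ∈ Finset.Icc 1 n, η (k + 1))⁻¹ • ∑ k ∈ Finset.Icc 1 n, η (k + 1) • S k ω

/-- The step sizes `η_{k+1} = 1_{k ≤ n-1} / √((1 + √‖a‖_{exp,2}) n)`, `k ≥ 0`, for the horizon
`n ≥ 1`; that is, the value at the index `j = k + 1` is nonzero exactly for `j ≤ n`. -/
def constStep {p : ℕ} (a : Vec p) (n : ℕ) (j : ℕ) : ℝ :=
  if j ≤ n then 1 / √((1 + √(expNorm a 2)) * n) else 0

/-- The step sizes `η_j = η₀ j^{-1/2}`. -/
def decrStep (η₀ : ℝ) (j : ℕ) : ℝ := η₀ * (j : ℝ) ^ (-(1 / 2) : ℝ)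

/-- The standing assumptions.
* `X` has independent components, `Y = f(X)` has a finite fourth moment and positive variance;
* `a` is a probability vector on `Υ`;
* `(X_n, X'_n, U_n)`, `n ≥ 1`, are i.i.d. with law `ℚ ⊗ ℚ ⊗ L^a`;
* `Ŝ_1 = S₁` lies in the open simplex and is a measurable function of `(X_1, X'_1, U_1)`
  (for instance a constant), with `E[D_h(S*, Ŝ_1)] < ∞`. -/
structure Setting {p : ℕ} (μ : Fin p → Measure ℝ) (f : (Fin p → ℝ) → ℝ) (a : Vec p)
    {Ω : Type*} [MeasurableSpace Ω] (P : Measure Ω) (X X' : ℕ → Ω → Fin p → ℝ)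
    (U : ℕ → Ω → Finset (Fin p)) (S₁ : Ω → Vec p) : Prop where
  isProb_input : ∀ i, IsProbabilityMeasure (μ i)
  measurable_f : Measurable f
  integrable_pow_four : Integrable (fun x => f x ^ 4) (inputLaw μ)
  varY_pos : 0 < varY μ f
  weight_nonneg : ∀ u, 0 ≤ a u
  weight_sum : ∑ u, a u = 1
  isProb : IsProbabilityMeasure P
  measurable_sample : ∀ n, 1 ≤ n → Measurable (fun ω => (X n ω, X' n ω, U n ω))
  law_sample : ∀ n, 1 ≤ n → P.map (fun ω => (X n ω, X' n ω, U n ω)) =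
    (inputLaw μ).prod ((inputLaw μ).prod (subsetLaw a))
  indep_sample : iIndepFun (fun (n : ℕ) ω => (X (n + 1) ω, X' (n + 1) ω, U (n + 1) ω)) P
  init_mem : ∀ ω, S₁ ω ∈ openSimplex p
  init_measurable : Measurable[MeasurableSpace.comap
    (fun ω => (X 1 ω, X' 1 ω, U 1 ω)) inferInstance] S₁
  init_integrable : Integrable (fun ω => bregman (sobolIndex μ f) (S₁ ω)) P

/-- `E[Φ^a(Z)] - min_{Δ_q} Φ^a ≤ B` for a random vector `Z`: the expectation exists, the minimum
is attained, and the inequality holds. -/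
def RiskBound {p : ℕ} (μ : Fin p → Measure ℝ) (f : (Fin p → ℝ) → ℝ) (a : Vec p)
    {Ω : Type*} [MeasurableSpace Ω] (P : Measure Ω) (Z : Ω → Vec p) (B : ℝ) : Prop :=
  Integrable (fun ω => Phi μ f a (Z ω)) P ∧
    ∃ m : ℝ, IsLeast (Phi μ f a '' simplex p) m ∧ (∫ ω, Phi μ f a (Z ω) ∂P) - m ≤ B

end

end PickFreeze

open PickFreeze

/-! Let E_v average over the coordinates outside v, and let g be the centred output. The operators
E_v are self-adjoint and E_v E_w = E_{v∩w}. Hence the variance of E[Y | X^i, i ∈ v] is the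
pick-freeze covariance of Y and Y^{(v)}, and each Sobol index is a squared L² norm divided by
Var(Y). So S* lies in the simplex. Each ψ_u is a quadratic in θ minimised at [M⁻¹S*]_u, and Φ^a(s) −
Φ^a(S*) is Var(Y)/2 times the a-weighted sum of the squares of [M⁻¹(s − S*)]_u (`Phi_eq`). Thus S*
is a minimiser and Φ^a is convex.

The rate is a regret bound for entropic mirror descent. The gradient estimator is a scalar residual
times a row of M⁻¹ with entries 0 and 1. The normalising constant of a step is therefore the moment
generating function of a two-valued variable, and the second-order cost is η² times the squared
residual, whatever the dimension (`bregman_mirrorStep_le`). That square has expectation at most 64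
E[Y⁴] (`Setting.integral_stepResidual_sq`).

Given the past, the residual times the error of the iterate has mean at least twice the gap in Φ^a,
minus a quarter of the squared error of the empirical mean (`le_integral_residual_mul`). The latter
has expectation Var(Y)/k at step k, so centring costs a sum of η_{k+1}/k. Telescoping and convexity
give `Setting.riskBound_cesaro`, which is then evaluated for the two step sizes. -/

namespace PickFreeze

/-! ### Freezing coordinates and the averaging operators E_v. -/

section Freeze

variable {p : ℕ} {μ : Fin p → Measure ℝ} [∀ i, IsProbabilityMeasure (μ i)]

instance isProbabilityMeasure_inputLaw : IsProbabilityMeasure (inputLaw μ) := by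
  unfold inputLaw; infer_instance

theorem measurable_freeze (u : Finset (Fin p)) :
    Measurable (fun z : (Fin p → ℝ) × (Fin p → ℝ) => freeze u z.1 z.2) := by
  refine measurable_pi_lambda _ fun i => ?_
  unfold freeze
  by_cases h : i ∈ u
  · simp only [h, if_true]; fun_prop
  · simp only [h, if_false]; fun_prop

theorem freeze_freeze (v w : Finset (Fin p)) (x x' x'' : Fin p → ℝ) :
    freeze w (freeze v x x') x'' = freeze (v ∩ w) x (freeze w x' x'') := by
  funext i
  simp only [freeze, Finset.mem_inter]
  by_cases hv : i ∈ v <;> by_cases hw : i ∈ w <;> simp [hv, hw]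

variable (μ) in
/-- Exchanging the coordinates outside `u` between two independent copies preserves their law. -/
theorem measurePreserving_freeze_swap (u : Finset (Fin p)) :
    MeasurePreserving (fun z : (Fin p → ℝ) × (Fin p → ℝ) => (freeze u z.1 z.2, freeze u z.2 z.1))
      ((inputLaw μ).prod (inputLaw μ)) ((inputLaw μ).prod (inputLaw μ)) := by
  -- Seen as a family of pairs (x_i, x'_i), the exchange acts on each coordinate by the identity or
  -- the swap, and both preserve μ_i ⊗ μ_i.
  have e := measurePreserving_arrowProdEquivProdArrow ℝ ℝ (Fin p) μ μ
  have h : MeasurePreserving (fun (a : Fin p → ℝ × ℝ) i => (if i ∈ u then id else Prod.swap) (a i))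
      (Measure.pi fun i => (μ i).prod (μ i)) (Measure.pi fun i => (μ i).prod (μ i)) := by
    refine measurePreserving_pi _ _ (f := fun i => if i ∈ u then id else Prod.swap) fun i => ?_
    split_ifs
    · exact MeasurePreserving.id _
    · exact Measure.measurePreserving_swap
  have := (e.comp h).comp (e.symm _)
  change MeasurePreserving _ ((inputLaw μ).prod (inputLaw μ))
    ((inputLaw μ).prod (inputLaw μ)) at this
  convert this using 1
  funext z
  ext i
  · by_cases hi : i ∈ u <;> simp [freeze, hi, MeasurableEquiv.arrowProdEquivProdArrow,
      Equiv.arrowProdEquivProdArrow]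
  · by_cases hi : i ∈ u <;> simp [freeze, hi, MeasurableEquiv.arrowProdEquivProdArrow,
      Equiv.arrowProdEquivProdArrow]

variable (μ) in
theorem measurePreserving_freeze (u : Finset (Fin p)) :
    MeasurePreserving (fun z : (Fin p → ℝ) × (Fin p → ℝ) => freeze u z.1 z.2)
      ((inputLaw μ).prod (inputLaw μ)) (inputLaw μ) :=
  (measurePreserving_fst (μ := inputLaw μ) (ν := inputLaw μ)).comp
    (measurePreserving_freeze_swap μ u)

theorem integral_comp_measurePreserving {α β : Type*} [MeasurableSpace α] [MeasurableSpace β]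
    {ν : Measure α} {ρ : Measure β} {φ : α → β} (h : MeasurePreserving φ ν ρ) {g : β → ℝ}
    (hg : AEStronglyMeasurable g ρ) : ∫ x, g (φ x) ∂ν = ∫ y, g y ∂ρ := by
  rw [← h.map_eq] at hg ⊢
  rw [integral_map h.measurable.aemeasurable hg]

theorem integrable_comp_measurePreserving {α β : Type*} [MeasurableSpace α] [MeasurableSpace β]
    {ν : Measure α} {ρ : Measure β} {φ : α → β} (h : MeasurePreserving φ ν ρ) {g : β → ℝ}
    (hg : Integrable g ρ) : Integrable (fun x => g (φ x)) ν :=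
  h.integrable_comp_of_integrable hg

/-- The conditional expectation given the coordinates in `v`, as an integral over the others. -/
noncomputable def margin (μ : Fin p → Measure ℝ) (v : Finset (Fin p)) (f : (Fin p → ℝ) → ℝ)
    (x : Fin p → ℝ) : ℝ :=
  ∫ x', f (freeze v x x') ∂(inputLaw μ)

theorem measurable_margin {f : (Fin p → ℝ) → ℝ} (hf : Measurable f) (v : Finset (Fin p)) :
    Measurable (margin μ v f) := by
  have h : StronglyMeasurable (Function.uncurry fun x x' => f (freeze v x x')) :=
    (hf.comp (measurable_freeze v)).stronglyMeasurable
  exact h.integral_prod_right.measurable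

theorem coordSigma_le (v : Finset (Fin p)) :
    coordSigma v ≤ (inferInstance : MeasurableSpace (Fin p → ℝ)) :=
  Measurable.comap_le (by fun_prop)

theorem freeze_eq_of_eqOn {v : Finset (Fin p)} {x y : Fin p → ℝ} (h : ∀ i ∈ v, x i = y i)
    (x' : Fin p → ℝ) : freeze v x x' = freeze v y x' := by
  funext i
  by_cases hi : i ∈ v <;> simp [freeze, hi, h]

theorem measurable_coordSigma_margin {f : (Fin p → ℝ) → ℝ} (hf : Measurable f)
    (v : Finset (Fin p)) : Measurable[coordSigma v] (margin μ v f) := by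
  -- The coordinates outside v are filled with the arbitrary value 0, which `margin` ignores.
  have h : margin μ v f = (fun y : v → ℝ => margin μ v f
      (fun i => if h : i ∈ v then y ⟨i, h⟩ else 0)) ∘ (fun (x : Fin p → ℝ) (i : v) => x i) := by
    funext x
    refine integral_congr_ae (Filter.Eventually.of_forall fun x' => ?_)
    refine congrArg f (freeze_eq_of_eqOn (fun i hi => ?_) x')
    simp [hi]
  rw [h]
  refine Measurable.comp ?_ (comap_measurable _)
  refine (measurable_margin hf v).comp (measurable_pi_lambda _ fun i => ?_)
  by_cases hi : i ∈ v
  · simp only [hi, dif_pos]; fun_prop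
  · simp only [hi, dif_neg, not_false_iff]; fun_prop

theorem condExp_coordSigma {f : (Fin p → ℝ) → ℝ} (hf : Measurable f)
    (hfi : Integrable f (inputLaw μ)) (v : Finset (Fin p)) :
    margin μ v f =ᵐ[inputLaw μ] (inputLaw μ)[f | coordSigma v] := by
  have hmp := measurePreserving_freeze μ v
  have hint : Integrable (fun z : (Fin p → ℝ) × (Fin p → ℝ) => f (freeze v z.1 z.2))
      ((inputLaw μ).prod (inputLaw μ)) := hmp.integrable_comp_of_integrable hfi
  have hmi : Integrable (margin μ v f) (inputLaw μ) := hint.integral_prod_left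
  refine ae_eq_condExp_of_forall_setIntegral_eq (coordSigma_le v) hfi
    (fun s _ _ => hmi.integrableOn) (fun s hs _ => ?_)
    (measurable_coordSigma_margin hf v).stronglyMeasurable.aestronglyMeasurable
  have hs' : MeasurableSet s := coordSigma_le v s hs
  -- An event of `coordSigma v` sees only the coordinates in v, and freezing keeps those.
  have hmem : ∀ x x', freeze v x x' ∈ s ↔ x ∈ s := by
    obtain ⟨t, -, rfl⟩ := hs
    intro x x'
    simp only [Set.mem_preimage]
    have : (fun i : v => freeze v x x' i) = fun i : v => x i := by
      funext i; simp [freeze]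
    rw [this]
  rw [← integral_indicator hs', ← integral_indicator hs',
    ← integral_comp_measurePreserving hmp (hf.indicator hs').aestronglyMeasurable,
    integral_prod _ (integrable_comp_measurePreserving hmp (hfi.indicator hs'))]
  refine integral_congr_ae (Filter.Eventually.of_forall fun x => ?_)
  by_cases hx : x ∈ s
  · simp [hx, Set.indicator, hmem, margin]
  · simp [hx, Set.indicator, hmem]

theorem memLp_margin {f : (Fin p → ℝ) → ℝ} (hf : Measurable f)
    (h2 : MemLp f 2 (inputLaw μ)) (v : Finset (Fin p)) : MemLp (margin μ v f) 2 (inputLaw μ) :=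
  (memLp_congr_ae (condExp_coordSigma hf (h2.integrable (by norm_num)) v)).2
    (h2.condExp (by norm_num))

theorem integral_margin {f : (Fin p → ℝ) → ℝ} (hf : Measurable f)
    (hfi : Integrable f (inputLaw μ)) (v : Finset (Fin p)) :
    ∫ x, margin μ v f x ∂(inputLaw μ) = ∫ x, f x ∂(inputLaw μ) := by
  rw [integral_congr_ae (condExp_coordSigma hf hfi v), integral_condExp (coordSigma_le v)]

theorem integrable_mul_freeze {f g : (Fin p → ℝ) → ℝ}
    (h2 : MemLp f 2 (inputLaw μ)) (hg2 : MemLp g 2 (inputLaw μ)) (v : Finset (Fin p)) :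
    Integrable (fun z : (Fin p → ℝ) × (Fin p → ℝ) => f z.1 * g (freeze v z.1 z.2))
      ((inputLaw μ).prod (inputLaw μ)) :=
  (h2.comp_measurePreserving (measurePreserving_fst (μ := inputLaw μ) (ν := inputLaw μ))).integrable_mul
    (hg2.comp_measurePreserving (measurePreserving_freeze μ v))

theorem integral_mul_margin {f g : (Fin p → ℝ) → ℝ}
    (h2 : MemLp f 2 (inputLaw μ)) (hg2 : MemLp g 2 (inputLaw μ)) (v : Finset (Fin p)) :
    ∫ x, f x * margin μ v g x ∂(inputLaw μ) =
      ∫ z : (Fin p → ℝ) × (Fin p → ℝ), f z.1 * g (freeze v z.1 z.2)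
        ∂((inputLaw μ).prod (inputLaw μ)) := by
  rw [integral_prod _ (integrable_mul_freeze h2 hg2 v)]
  simp only [integral_const_mul, margin]

/-- Both sides are pick-freeze integrals, and exchanging the coordinates outside v between the two
copies turns one into the other. -/
theorem margin_selfAdjoint {f g : (Fin p → ℝ) → ℝ} (hf : Measurable f)
    (h2 : MemLp f 2 (inputLaw μ)) (hg : Measurable g) (hg2 : MemLp g 2 (inputLaw μ))
    (v : Finset (Fin p)) :
    ∫ x, margin μ v f x * g x ∂(inputLaw μ) = ∫ x, f x * margin μ v g x ∂(inputLaw μ) := by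
  simp_rw [mul_comm (margin μ v f _) (g _)]
  rw [integral_mul_margin h2 hg2, integral_mul_margin hg2 h2,
    ← integral_comp_measurePreserving (measurePreserving_freeze_swap μ v)]
  · refine integral_congr_ae (Filter.Eventually.of_forall fun z => ?_)
    have : freeze v (freeze v z.1 z.2) (freeze v z.2 z.1) = z.1 := by
      funext i; by_cases hi : i ∈ v <;> simp [freeze, hi]
    simp only [this]
    ring
  · exact ((hg.comp measurable_fst).mul (hf.comp (measurable_freeze v))).aestronglyMeasurable

/-- Nested freezing keeps x only on v ∩ w, and the other coordinates again follow the input law. The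
identity holds almost everywhere because Fubini needs an integrable slice at x. -/
theorem margin_margin {f : (Fin p → ℝ) → ℝ}
    (hfi : Integrable f (inputLaw μ)) (v w : Finset (Fin p)) :
    margin μ v (margin μ w f) =ᵐ[inputLaw μ] margin μ (v ∩ w) f := by
  have hint : Integrable (fun z : (Fin p → ℝ) × (Fin p → ℝ) => f (freeze (v ∩ w) z.1 z.2))
      ((inputLaw μ).prod (inputLaw μ)) :=
    (measurePreserving_freeze μ _).integrable_comp_of_integrable hfi
  filter_upwards [hint.prod_right_ae] with x hx
  simp only [margin, freeze_freeze]
  have hmp := measurePreserving_freeze μ w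
  rw [← integral_comp_measurePreserving hmp hx.aestronglyMeasurable,
    integral_prod _ (integrable_comp_measurePreserving hmp hx)]

theorem integral_margin_mul_margin {f : (Fin p → ℝ) → ℝ} (hf : Measurable f)
    (h2 : MemLp f 2 (inputLaw μ)) (v w : Finset (Fin p)) :
    ∫ x, margin μ v f x * margin μ w f x ∂(inputLaw μ) =
      ∫ x, f x * margin μ (v ∩ w) f x ∂(inputLaw μ) := by
  rw [margin_selfAdjoint hf h2 (measurable_margin hf w) (memLp_margin hf h2 w)]
  refine integral_congr_ae ?_
  filter_upwards [margin_margin (h2.integrable (by norm_num)) v w] with x hx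
  rw [hx]

end Freeze

/-! ### Möbius inversion on the lattice of subsets. -/

section Mobius

variable {p : ℕ}

theorem isUnit_det_mobius (p : ℕ) : IsUnit (mobius p).det := by
  by_contra h
  -- By convention a singular matrix has inverse 0, while `mobius_inv` gives the entry 1 at (∅, ∅).
  have h0 := Matrix.nonsing_inv_apply_not_isUnit _ h
  have h1 := congrFun (congrFun (h0.symm.trans (mobius_inv p)) ∅) ∅
  simp at h1

theorem mobius_mul_inv (p : ℕ) : mobius p * (mobius p)⁻¹ = 1 :=
  Matrix.mul_nonsing_inv _ (isUnit_det_mobius p)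

theorem mobius_inv_apply (u v : Finset (Fin p)) :
    (mobius p)⁻¹ u v = if v ⊆ u then 1 else 0 := by
  rw [mobius_inv]; rfl

theorem mobius_inv_inter (v w t : Finset (Fin p)) :
    (mobius p)⁻¹ (v ∩ w) t = (mobius p)⁻¹ v t * (mobius p)⁻¹ w t := by
  simp only [mobius_inv_apply, Finset.subset_inter_iff]
  by_cases h1 : t ⊆ v <;> by_cases h2 : t ⊆ w <;> simp [h1, h2]

theorem mobius_inv_mulVec_mobius_mulVec (C : Vec p) :
    (mobius p)⁻¹.mulVec ((mobius p).mulVec C) = C := by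
  rw [Matrix.mulVec_mulVec, Matrix.nonsing_inv_mul _ (isUnit_det_mobius p), Matrix.one_mulVec]

theorem mobius_mulVec_apply (C : Vec p) (u : Finset (Fin p)) :
    (mobius p).mulVec C u = ∑ v ∈ u.powerset, (-1 : ℝ) ^ (u.card - v.card) * C v := by
  have : u.powerset = Finset.univ.filter (· ⊆ u) := by ext; simp
  simp only [Matrix.mulVec, dotProduct, mobius, Matrix.of_apply, ite_mul, zero_mul]
  rw [this, Finset.sum_filter]

/-- The Möbius transform as a quadratic form in the kernel `(v, w) ↦ C (v ∩ w)`. -/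
theorem mobius_mulVec_eq_sum_sum (C : Vec p) (u : Finset (Fin p)) :
    (mobius p).mulVec C u = ∑ v, ∑ w, mobius p u v * mobius p u w * C (v ∩ w) := by
  set V := (mobius p).mulVec C with hV
  -- Rows of M⁻¹ multiply under intersection, so the kernel C (v ∩ w) is M⁻¹ diag(V) (M⁻¹)ᵀ.
  -- Conjugating by M leaves diag(V).
  have hC : ∀ v w, C (v ∩ w) = ∑ t, (mobius p)⁻¹ v t * (mobius p)⁻¹ w t * V t := by
    intro v w
    conv_lhs => rw [← mobius_inv_mulVec_mobius_mulVec C]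
    simp only [Matrix.mulVec, dotProduct, ← mobius_inv_inter, hV]
  have h1 : ∀ t, ∑ v, mobius p u v * (mobius p)⁻¹ v t = if u = t then 1 else 0 := by
    intro t
    rw [← Matrix.mul_apply, mobius_mul_inv, Matrix.one_apply]
  calc V u = ∑ t, (∑ v, mobius p u v * (mobius p)⁻¹ v t) *
        (∑ w, mobius p u w * (mobius p)⁻¹ w t) * V t := by simp [h1]
    _ = _ := by
      simp only [hC, Finset.sum_mul_sum]
      simp only [Finset.sum_mul, Finset.mul_sum]
      rw [Finset.sum_comm]
      refine Finset.sum_congr rfl fun v _ => ?_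
      rw [Finset.sum_comm]
      exact Finset.sum_congr rfl fun w _ => Finset.sum_congr rfl fun t _ => by ring

theorem mulVec_mem_Icc {s : Vec p} (hs : s ∈ simplex p) (u : Finset (Fin p)) :
    (mobius p)⁻¹.mulVec s u ∈ Set.Icc (0 : ℝ) 1 := by
  have h : (mobius p)⁻¹.mulVec s u = ∑ v, if v ⊆ u then s v else 0 := by
    simp [Matrix.mulVec, dotProduct, mobius_inv_apply]
  rw [h]
  refine ⟨Finset.sum_nonneg fun v _ => ?_, ?_⟩
  · split_ifs; exacts [hs.1 v, le_rfl]
  · rw [← hs.2.2]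
    refine Finset.sum_le_sum fun v _ => ?_
    split_ifs; exacts [le_rfl, hs.1 v]

end Mobius

/-! ### Sobol indices lie in the simplex and minimise the objective. -/

section Sobol

variable {p : ℕ} {μ : Fin p → Measure ℝ} {f : (Fin p → ℝ) → ℝ}

theorem varY_eq (h2 : MemLp f 2 (inputLaw μ)) :
    varY μ f = ∫ x, (f x - meanY μ f) ^ 2 ∂(inputLaw μ) :=
  variance_eq_integral h2.aestronglyMeasurable.aemeasurable

theorem sobolIndex_eq (u : Finset (Fin p)) :
    sobolIndex μ f u = (mobius p).mulVec (closedVar μ f) u / varY μ f := by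
  rw [mobius_mulVec_apply]; rfl

theorem mobius_inv_mulVec_sobolIndex (u : Finset (Fin p)) :
    (mobius p)⁻¹.mulVec (sobolIndex μ f) u = closedVar μ f u / varY μ f := by
  have h : sobolIndex μ f = (varY μ f)⁻¹ • (mobius p).mulVec (closedVar μ f) := by
    funext u
    rw [sobolIndex_eq, Pi.smul_apply, smul_eq_mul]; ring
  rw [h, Matrix.mulVec_smul, mobius_inv_mulVec_mobius_mulVec, Pi.smul_apply, smul_eq_mul]
  ring

variable [∀ i, IsProbabilityMeasure (μ i)]

theorem memLp_sub_meanY (h2 : MemLp f 2 (inputLaw μ)) :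
    MemLp (fun x => f x - meanY μ f) 2 (inputLaw μ) := h2.sub (memLp_const _)

theorem integral_sub_meanY (h2 : MemLp f 2 (inputLaw μ)) :
    ∫ x, (f x - meanY μ f) ∂(inputLaw μ) = 0 := by
  rw [integral_sub (h2.integrable (by norm_num)) (integrable_const _)]
  simp [meanY]

theorem closedVar_eq_integral_margin_sq (hf : Measurable f) (h2 : MemLp f 2 (inputLaw μ))
    (v : Finset (Fin p)) :
    closedVar μ f v = ∫ x, margin μ v (fun x => f x - meanY μ f) x *
      margin μ v (fun x => f x - meanY μ f) x ∂(inputLaw μ) := by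
  have hi : Integrable f (inputLaw μ) := h2.integrable (by norm_num)
  set g := fun x => f x - meanY μ f with hg
  have hgm : Measurable g := hf.sub_const _
  have hg2 : MemLp g 2 (inputLaw μ) := memLp_sub_meanY h2
  have h1 : (inputLaw μ)[f | coordSigma v] =ᵐ[inputLaw μ]
      fun x => margin μ v g x + meanY μ f := by
    have e1 : (inputLaw μ)[g | coordSigma v] =ᵐ[inputLaw μ] _ :=
      condExp_sub hi (integrable_const (meanY μ f)) (coordSigma v)
    filter_upwards [e1, condExp_coordSigma hgm (hg2.integrable (by norm_num)) v] with x a b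
    rw [b, a]
    simp [condExp_const (coordSigma_le v)]
  have hm := memLp_margin hgm hg2 v
  rw [closedVar, variance_congr h1, variance_add_const hm.aestronglyMeasurable,
    variance_eq_integral hm.aestronglyMeasurable.aemeasurable,
    integral_margin hgm (hg2.integrable (by norm_num)), integral_sub_meanY h2]
  simp [sq]

/-- Since E_v is self-adjoint and idempotent, ‖E_v g‖² = ⟨g, E_v g⟩, and X' plays the part of the
integration variable in E_v. -/
theorem closedVar_eq_cov (hf : Measurable f) (h2 : MemLp f 2 (inputLaw μ))
    (v : Finset (Fin p)) :
    closedVar μ f v = ∫ z : (Fin p → ℝ) × (Fin p → ℝ), (f z.1 - meanY μ f) *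
      (f (freeze v z.1 z.2) - meanY μ f) ∂((inputLaw μ).prod (inputLaw μ)) := by
  rw [closedVar_eq_integral_margin_sq hf h2, integral_margin_mul_margin (hf.sub_const _)
    (memLp_sub_meanY h2), Finset.inter_self,
    integral_mul_margin (memLp_sub_meanY h2) (memLp_sub_meanY h2)]

/-- The value is the squared norm of Σ_v M_{u,v} E_v g, the Hoeffding component of Y at u. Expanding
the square gives the quadratic form of `mobius_mulVec_eq_sum_sum`, because ⟨E_v g, E_w g⟩ depends
only on v ∩ w. -/
theorem mobius_mulVec_closedVar_nonneg (hf : Measurable f) (h2 : MemLp f 2 (inputLaw μ))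
    (u : Finset (Fin p)) : 0 ≤ (mobius p).mulVec (closedVar μ f) u := by
  set g := fun x => f x - meanY μ f with hg
  have hgm : Measurable g := hf.sub_const _
  have hg2 : MemLp g 2 (inputLaw μ) := memLp_sub_meanY h2
  have hm := memLp_margin hgm hg2
  have hi : ∀ v w, Integrable (fun x => mobius p u v * mobius p u w *
      (margin μ v g x * margin μ w g x)) (inputLaw μ) := fun v w =>
    ((hm v).integrable_mul (hm w)).const_mul _
  have key : (mobius p).mulVec (closedVar μ f) u =
      ∫ x, (∑ v, mobius p u v * margin μ v g x) ^ 2 ∂(inputLaw μ) := by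
    have : ∀ x, (∑ v, mobius p u v * margin μ v g x) ^ 2 =
        ∑ v, ∑ w, mobius p u v * mobius p u w * (margin μ v g x * margin μ w g x) := by
      intro x
      rw [sq, Finset.sum_mul_sum]
      refine Finset.sum_congr rfl fun v _ => Finset.sum_congr rfl fun w _ => by ring
    simp only [this]
    rw [integral_finsetSum _ fun v _ => integrable_finsetSum _ fun w _ => hi v w,
      mobius_mulVec_eq_sum_sum]
    refine Finset.sum_congr rfl fun v _ => ?_
    rw [integral_finsetSum _ fun w _ => hi v w]
    refine Finset.sum_congr rfl fun w _ => ?_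
    rw [integral_const_mul, integral_margin_mul_margin hgm hg2,
      closedVar_eq_integral_margin_sq hf h2, integral_margin_mul_margin hgm hg2,
      Finset.inter_self]
  rw [key]
  exact integral_nonneg fun x => sq_nonneg _

theorem closedVar_empty (hf : Measurable f) (h2 : MemLp f 2 (inputLaw μ)) :
    closedVar μ f ∅ = 0 := by
  have h : ∀ x, margin μ ∅ (fun x => f x - meanY μ f) x = 0 := by
    intro x
    have : ∀ x', freeze ∅ x x' = x' := fun x' => by funext i; simp [freeze]
    simp only [margin, this]
    exact integral_sub_meanY h2
  rw [closedVar_eq_integral_margin_sq hf h2]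
  simp [h]

theorem closedVar_univ (hf : Measurable f) (h2 : MemLp f 2 (inputLaw μ)) :
    closedVar μ f Finset.univ = varY μ f := by
  have h : ∀ x, margin μ Finset.univ (fun x => f x - meanY μ f) x = f x - meanY μ f := by
    intro x
    have : ∀ x', freeze Finset.univ x x' = x := fun x' => by funext i; simp [freeze]
    simp [margin, this]
  rw [closedVar_eq_integral_margin_sq hf h2, varY_eq h2]
  simp [h, sq]

theorem sobolIndex_mem_simplex (hf : Measurable f) (h2 : MemLp f 2 (inputLaw μ))
    (hpos : 0 < varY μ f) : sobolIndex μ f ∈ simplex p := by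
  refine ⟨fun u => ?_, ?_, ?_⟩
  · rw [sobolIndex_eq]
    exact div_nonneg (mobius_mulVec_closedVar_nonneg hf h2 u) hpos.le
  · simp [sobolIndex, closedVar_empty hf h2]
  · have h := mobius_inv_mulVec_sobolIndex (μ := μ) (f := f) Finset.univ
    rw [closedVar_univ hf h2, div_self hpos.ne'] at h
    simpa [Matrix.mulVec, dotProduct, mobius_inv_apply] using h

theorem psi_eq (hf : Measurable f) (h2 : MemLp f 2 (inputLaw μ)) (u : Finset (Fin p)) (θ : ℝ) :
    psi μ f u θ = varY μ f * (θ ^ 2 + 1) - 2 * θ * closedVar μ f u := by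
  have hg2 := memLp_sub_meanY h2
  have hs : Integrable (fun x => (f x - meanY μ f) ^ 2) (inputLaw μ) := hg2.integrable_sq
  have hgm : Measurable fun x => f x - meanY μ f := hf.sub_const _
  have i1 : Integrable (fun z : (Fin p → ℝ) × (Fin p → ℝ) => θ ^ 2 * (f z.1 - meanY μ f) ^ 2)
      ((inputLaw μ).prod (inputLaw μ)) :=
    (integrable_comp_measurePreserving measurePreserving_fst hs).const_mul _
  have i2 : Integrable (fun z : (Fin p → ℝ) × (Fin p → ℝ) =>
      (f (freeze u z.1 z.2) - meanY μ f) ^ 2) ((inputLaw μ).prod (inputLaw μ)) :=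
    integrable_comp_measurePreserving (measurePreserving_freeze μ u) hs
  have i3 : Integrable (fun z : (Fin p → ℝ) × (Fin p → ℝ) =>
      2 * θ * ((f z.1 - meanY μ f) * (f (freeze u z.1 z.2) - meanY μ f)))
      ((inputLaw μ).prod (inputLaw μ)) := (integrable_mul_freeze hg2 hg2 u).const_mul _
  have i12 : Integrable (fun z : (Fin p → ℝ) × (Fin p → ℝ) => θ ^ 2 * (f z.1 - meanY μ f) ^ 2 +
      (f (freeze u z.1 z.2) - meanY μ f) ^ 2) ((inputLaw μ).prod (inputLaw μ)) := i1.add i2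
  have e : ∀ z : (Fin p → ℝ) × (Fin p → ℝ),
      ((f z.1 - meanY μ f) * θ - (f (freeze u z.1 z.2) - meanY μ f)) ^ 2 =
      θ ^ 2 * (f z.1 - meanY μ f) ^ 2 + (f (freeze u z.1 z.2) - meanY μ f) ^ 2 -
      2 * θ * ((f z.1 - meanY μ f) * (f (freeze u z.1 z.2) - meanY μ f)) := fun z => by ring
  have hs' := hs.aestronglyMeasurable
  simp only [psi, e]
  rw [integral_sub i12 i3, integral_add i1 i2, integral_const_mul, integral_const_mul,
    integral_comp_measurePreserving (measurePreserving_freeze μ u) hs',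
    integral_comp_measurePreserving measurePreserving_fst hs', ← closedVar_eq_cov hf h2,
    ← varY_eq h2]
  ring

/-- Completing the square in each ψ_u. Minimality of S*, convexity and measurability of the
objective are all read off this formula. -/
theorem Phi_eq (hf : Measurable f) (h2 : MemLp f 2 (inputLaw μ)) (hpos : 0 < varY μ f)
    (a s : Vec p) :
    Phi μ f a s = Phi μ f a (sobolIndex μ f) + varY μ f / 2 * ∑ u, a u *
      ((mobius p)⁻¹.mulVec s u - (mobius p)⁻¹.mulVec (sobolIndex μ f) u) ^ 2 := by
  simp only [Phi, Psi, psi_eq hf h2, mobius_inv_mulVec_sobolIndex, Finset.mul_sum]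
  rw [← Finset.sum_add_distrib]
  refine Finset.sum_congr rfl fun u _ => ?_
  field_simp
  ring

theorem isLeast_Phi (hf : Measurable f) (h2 : MemLp f 2 (inputLaw μ)) (hpos : 0 < varY μ f)
    {a : Vec p} (ha : ∀ u, 0 ≤ a u) :
    IsLeast (Phi μ f a '' simplex p) (Phi μ f a (sobolIndex μ f)) := by
  refine ⟨⟨_, sobolIndex_mem_simplex hf h2 hpos, rfl⟩, ?_⟩
  rintro _ ⟨s, -, rfl⟩
  rw [Phi_eq hf h2 hpos a s]
  have : 0 ≤ ∑ u, a u *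
      ((mobius p)⁻¹.mulVec s u - (mobius p)⁻¹.mulVec (sobolIndex μ f) u) ^ 2 :=
    Finset.sum_nonneg fun u _ => mul_nonneg (ha u) (sq_nonneg _)
  nlinarith

end Sobol

/-! ### One step of entropic mirror descent. -/

section Mirror

variable {p : ℕ}

/-- The linear term stands alone so that it cancels when averaged over a centred variable. For |x| ≤
1 it is a second-order Taylor bound; beyond, x ≤ x² or e^x ≤ 1 suffices. -/
theorem exp_le_add_exp_sq (x : ℝ) : Real.exp x ≤ x + Real.exp (x ^ 2) := by
  have h2 := Real.add_one_le_exp (x ^ 2)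
  rcases le_or_gt |x| 1 with h | h
  · have := (abs_le.1 (Real.abs_exp_sub_one_sub_id_le h)).2
    linarith
  · rcases le_or_gt 0 x with h0 | h0
    · rw [abs_of_nonneg h0] at h
      have : Real.exp x ≤ Real.exp (x ^ 2) := Real.exp_le_exp.2 (by nlinarith)
      linarith
    · rw [abs_of_neg h0] at h
      have : Real.exp x ≤ 1 := Real.exp_le_one_iff.2 h0.le
      nlinarith

/-- Log-moment bound for a variable with the two values `0` and `x`. -/
theorem log_two_point_le {θ : ℝ} (hθ : θ ∈ Set.Icc (0 : ℝ) 1) (x : ℝ) :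
    Real.log (1 - θ + θ * Real.exp x) ≤ θ * x + x ^ 2 := by
  obtain ⟨h0, h1⟩ := hθ
  have hpos : 0 < 1 - θ + θ * Real.exp x := by
    rcases h0.eq_or_lt with rfl | h
    · simp
    · have := mul_pos h (Real.exp_pos x); linarith
  rw [Real.log_le_iff_le_exp hpos]
  have e1 := exp_le_add_exp_sq (-(θ * x))
  have e2 := exp_le_add_exp_sq ((1 - θ) * x)
  have b1 : Real.exp ((-(θ * x)) ^ 2) ≤ Real.exp (x ^ 2) :=
    Real.exp_le_exp.2 (by nlinarith [mul_nonneg (sq_nonneg x) (by nlinarith : 0 ≤ 1 - θ ^ 2)])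
  have b2 : Real.exp (((1 - θ) * x) ^ 2) ≤ Real.exp (x ^ 2) :=
    Real.exp_le_exp.2 (by
      nlinarith [mul_nonneg (sq_nonneg x) (by nlinarith : 0 ≤ 1 - (1 - θ) ^ 2)])
  -- This is the centred two-point variable, −θx with weight 1 − θ and (1 − θ)x with weight θ: the
  -- linear terms cancel.
  have key : (1 - θ) * Real.exp (-(θ * x)) + θ * Real.exp ((1 - θ) * x) ≤ Real.exp (x ^ 2) := by
    nlinarith [mul_le_mul_of_nonneg_left (e1.trans (add_le_add_right b1 _))
      (by linarith : 0 ≤ 1 - θ), mul_le_mul_of_nonneg_left (e2.trans (add_le_add_right b2 _)) h0]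
  have : 1 - θ + θ * Real.exp x =
      Real.exp (θ * x) * ((1 - θ) * Real.exp (-(θ * x)) + θ * Real.exp ((1 - θ) * x)) := by
    have a1 : Real.exp (θ * x) * Real.exp (-(θ * x)) = 1 := by rw [← Real.exp_add]; simp
    have a2 : Real.exp (θ * x) * Real.exp ((1 - θ) * x) = Real.exp x := by
      rw [← Real.exp_add]; ring_nf
    linear_combination (-(1 - θ)) * a1 - θ * a2
  rw [this, Real.exp_add]
  exact mul_le_mul_of_nonneg_left key (Real.exp_pos _).le

theorem bregman_eq {w s : Vec p} (hw : w ∈ simplex p) (hs : s ∈ simplex p) :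
    bregman w s = ∑ u, w u * (Real.log (w u) - Real.log (s u)) := by
  have h : bregman w s = ∑ u, w u * (Real.log (w u) - Real.log (s u)) -
      (∑ u, w u - ∑ u, s u) := by
    simp only [bregman, negEntropy, ← Finset.sum_sub_distrib]
    exact Finset.sum_congr rfl fun u _ => by ring
  rw [h, hw.2.2, hs.2.2]; ring

/-- Gibbs' inequality, from log t ≤ t − 1 at t = s_u / w_u where w_u is positive. -/
theorem bregman_nonneg {w s : Vec p} (hw : w ∈ simplex p) (hs : s ∈ openSimplex p) :
    0 ≤ bregman w s := by
  rw [bregman_eq hw hs.1]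
  have h : ∑ u, (w u - s u) ≤ ∑ u, w u * (Real.log (w u) - Real.log (s u)) := by
    refine Finset.sum_le_sum fun u _ => ?_
    rcases (hw.1 u).eq_or_lt with h0 | h0
    · rw [← h0]; simpa using hs.1.1 u
    · have hu : u ≠ ∅ := by
        rintro rfl; rw [hw.2.1] at h0; exact lt_irrefl _ h0
      have hsu := hs.2 u hu
      have := Real.log_le_sub_one_of_pos (div_pos hsu h0)
      rw [Real.log_div hsu.ne' h0.ne'] at this
      have h3 := mul_le_mul_of_nonneg_left this h0.le
      have h4 : w u * (s u / w u - 1) = s u - w u := by field_simp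
      linarith
  rw [Finset.sum_sub_distrib, hw.2.2, hs.1.2.2] at h
  linarith

theorem sum_mul_exp_pos {s : Vec p} (hs : s ∈ openSimplex p) (c : Vec p) :
    0 < ∑ v, s v * Real.exp (c v) := by
  refine Finset.sum_pos' (fun v _ => mul_nonneg (hs.1.1 v) (Real.exp_pos _).le) ?_
  by_contra! h
  have h0 : ∀ v, s v = 0 := fun v => by
    have h1 := h v (Finset.mem_univ _)
    have h2 := hs.1.1 v
    by_contra h3
    exact absurd (mul_pos (lt_of_le_of_ne h2 (Ne.symm h3)) (Real.exp_pos (c v))) h1.not_gt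
  have := hs.1.2.2
  simp [h0] at this

theorem mirrorStep_apply {s : Vec p} (hs : s ∈ openSimplex p) (η : ℝ) (g : Vec p)
    (u : Finset (Fin p)) :
    mirrorStep η g s u = s u * Real.exp (-η * g u) / ∑ v, s v * Real.exp (-η * g v) := by
  unfold mirrorStep
  congr 1
  exact Finset.sum_congr rfl fun v _ => abs_of_nonneg (mul_nonneg (hs.1.1 v) (Real.exp_pos _).le)

theorem mirrorStep_mem {s : Vec p} (hs : s ∈ openSimplex p) (η : ℝ) (g : Vec p) :
    mirrorStep η g s ∈ openSimplex p := by
  have hZ := sum_mul_exp_pos hs (fun v => -η * g v)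
  refine ⟨⟨fun u => ?_, ?_, ?_⟩, fun u hu => ?_⟩
  · rw [mirrorStep_apply hs]
    exact div_nonneg (mul_nonneg (hs.1.1 u) (Real.exp_pos _).le) hZ.le
  · rw [mirrorStep_apply hs, hs.1.2.1]; simp
  · simp only [mirrorStep_apply hs]
    rw [← Finset.sum_div, div_self hZ.ne']
  · rw [mirrorStep_apply hs]
    exact div_pos (mul_pos (hs.2 u hu) (Real.exp_pos _)) hZ

/-- One step of mirror descent along a gradient proportional to the row `U` of `M⁻¹`. -/
theorem bregman_mirrorStep_le {w s : Vec p} (hw : w ∈ simplex p) (hs : s ∈ openSimplex p)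
    (η γ : ℝ) (U : Finset (Fin p)) :
    bregman w (mirrorStep η (fun v => γ * (mobius p)⁻¹ U v) s) ≤ bregman w s -
      η * (γ * ((mobius p)⁻¹.mulVec s U - (mobius p)⁻¹.mulVec w U)) + η ^ 2 * γ ^ 2 := by
  set g : Vec p := fun v => γ * (mobius p)⁻¹ U v with hg
  set θ := (mobius p)⁻¹.mulVec s U with hθ
  have hZ := sum_mul_exp_pos hs (fun v => -η * g v)
  -- The row of M⁻¹ takes only the values 0 and 1, and s gives mass θ to the value 1. This keeps the
  -- number of subsets out of the second-order term.
  have hZeq : ∑ v, s v * Real.exp (-η * g v) = 1 - θ + θ * Real.exp (-η * γ) := by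
    have e : ∀ v, s v * Real.exp (-η * g v) =
        s v - (mobius p)⁻¹ U v * s v + (mobius p)⁻¹ U v * s v * Real.exp (-η * γ) := by
      intro v
      simp only [hg, mobius_inv_apply]
      split_ifs <;> simp
    simp only [e, Finset.sum_add_distrib, Finset.sum_sub_distrib, ← Finset.sum_mul, hs.1.2.2]
    rfl
  have hlog := log_two_point_le (mulVec_mem_Icc hs.1 U) (-η * γ)
  rw [← hθ, ← hZeq] at hlog
  have hstep : ∀ u, w u * (Real.log (w u) - Real.log (mirrorStep η g s u)) =
      w u * (Real.log (w u) - Real.log (s u)) + η * γ * ((mobius p)⁻¹ U u * w u) +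
        w u * Real.log (∑ v, s v * Real.exp (-η * g v)) := by
    intro u
    -- At ∅ the logarithm of the product cannot be split, since s vanishes there; the factor w ∅ = 0
    -- removes the term.
    by_cases hu : u = ∅
    · subst hu; rw [hw.2.1]; simp
    · rw [mirrorStep_apply hs, Real.log_div (mul_pos (hs.2 u hu) (Real.exp_pos _)).ne' hZ.ne',
        Real.log_mul (hs.2 u hu).ne' (Real.exp_pos _).ne', Real.log_exp]
      simp only [hg]; ring
  rw [bregman_eq hw (mirrorStep_mem hs η g).1, bregman_eq hw hs.1]
  simp only [hstep, Finset.sum_add_distrib, ← Finset.sum_mul, ← Finset.mul_sum, hw.2.2]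
  have : ∑ u, (mobius p)⁻¹ U u * w u = (mobius p)⁻¹.mulVec w U := rfl
  rw [this]
  nlinarith [hlog]

end Mirror

/-! ### Integration against the law of one sample. -/

section Law

variable {p : ℕ}

theorem measurable_apply_of_finite {ι α : Type*} [MeasurableSpace ι] [Countable ι]
    [MeasurableSingletonClass ι] {m : MeasurableSpace α} {F : ι → α → ℝ} {U : α → ι}
    (hF : ∀ i, Measurable (F i)) (hU : Measurable U) : Measurable fun x => F (U x) x := by
  have h : Measurable fun z : ι × α => F z.1 z.2 := measurable_from_prod_countable_right hF
  exact h.comp (hU.prodMk measurable_id)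

theorem isProbabilityMeasure_subsetLaw {a : Vec p} (h0 : ∀ u, 0 ≤ a u) (h1 : ∑ u, a u = 1) :
    IsProbabilityMeasure (subsetLaw a) := by
  constructor
  simp [subsetLaw, ← ENNReal.ofReal_sum_of_nonneg (fun u _ => h0 u), h1]

theorem integral_ite_subsetLaw {a : Vec p} (h0 : ∀ u, 0 ≤ a u) (u : Finset (Fin p)) :
    ∫ y, (if y = u then (1 : ℝ) else 0) ∂(subsetLaw a) = a u := by
  rw [subsetLaw, integral_finsetSum_measure]
  · simp only [integral_smul_measure, integral_dirac, ENNReal.toReal_ofReal (h0 _)]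
    simp
  · intro v _
    exact (integrable_dirac (by simp)).smul_measure ENNReal.ofReal_ne_top

variable {μ : Fin p → Measure ℝ} [∀ i, IsProbabilityMeasure (μ i)]

/-- Integration against the law of a sample: average over the drawn subset. -/
theorem integral_sampleLaw {a : Vec p} (h0 : ∀ u, 0 ≤ a u) (h1 : ∑ u, a u = 1)
    {F : Finset (Fin p) → (Fin p → ℝ) × (Fin p → ℝ) → ℝ}
    (hF : ∀ u, Integrable (F u) ((inputLaw μ).prod (inputLaw μ))) :
    Integrable (fun t : (Fin p → ℝ) × (Fin p → ℝ) × Finset (Fin p) => F t.2.2 (t.1, t.2.1))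
        ((inputLaw μ).prod ((inputLaw μ).prod (subsetLaw a))) ∧
      ∫ t, F t.2.2 (t.1, t.2.1) ∂((inputLaw μ).prod ((inputLaw μ).prod (subsetLaw a))) =
        ∑ u, a u * ∫ z, F u z ∂((inputLaw μ).prod (inputLaw μ)) := by
  have := isProbabilityMeasure_subsetLaw h0 h1
  have hmp := measurePreserving_prodAssoc (inputLaw μ) (inputLaw μ) (subsetLaw a)
  -- The integrand is split over the value of the drawn subset, so that each piece is a product
  -- function.
  have hi : ∀ u, Integrable (fun t : ((Fin p → ℝ) × (Fin p → ℝ)) × Finset (Fin p) =>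
      F u t.1 * (if t.2 = u then 1 else 0)) (((inputLaw μ).prod (inputLaw μ)).prod (subsetLaw a)) :=
    fun u => (hF u).mul_prod (Integrable.of_finite (f := fun y => if y = u then (1 : ℝ) else 0))
  have e : (fun t : ((Fin p → ℝ) × (Fin p → ℝ)) × Finset (Fin p) => F t.2 t.1) =
      fun t => ∑ u, F u t.1 * (if t.2 = u then 1 else 0) := by
    funext t; simp
  have hsum : Integrable (fun t : ((Fin p → ℝ) × (Fin p → ℝ)) × Finset (Fin p) => F t.2 t.1)
      (((inputLaw μ).prod (inputLaw μ)).prod (subsetLaw a)) := by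
    rw [e]; exact integrable_finsetSum _ fun u _ => hi u
  constructor
  · rw [← hmp.integrable_comp_emb MeasurableEquiv.prodAssoc.measurableEmbedding]
    exact hsum
  · rw [← hmp.integral_comp MeasurableEquiv.prodAssoc.measurableEmbedding]
    change ∫ t : ((Fin p → ℝ) × (Fin p → ℝ)) × Finset (Fin p), F t.2 t.1 ∂_ = _
    rw [e, integral_finsetSum _ fun u _ => hi u]
    refine Finset.sum_congr rfl fun u _ => ?_
    rw [integral_prod_mul (F u) (fun y => if y = u then (1 : ℝ) else 0),
      integral_ite_subsetLaw h0, mul_comm]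

end Law

/-! ### Moments and bias of the residual. -/

section Residual

variable {p : ℕ}

/-- The scalar factor of the gradient estimator, at the sample `(x, x', u)`, the iterate `s` and
the centering `m`. -/
noncomputable def residual (f : (Fin p → ℝ) → ℝ) (m : ℝ) (s : Vec p) (u : Finset (Fin p))
    (x x' : Fin p → ℝ) : ℝ :=
  (f x - m) * ((f x - m) * (mobius p)⁻¹.mulVec s u - (f (freeze u x x') - m))

/-- With D and E the two centred outputs and θ ∈ [0, 1], the square is at most 2D²(D² + E²) ≤ 3D⁴ +
E⁴. Then (b − m)⁴ ≤ 8b⁴ + 8m⁴ gives 24, 8 and 32 = 24 + 8. -/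
theorem residual_sq_le {f : (Fin p → ℝ) → ℝ} {m : ℝ} {s : Vec p} (hs : s ∈ simplex p)
    (u : Finset (Fin p)) (x x' : Fin p → ℝ) :
    residual f m s u x x' ^ 2 ≤ 24 * f x ^ 4 + 8 * f (freeze u x x') ^ 4 + 32 * m ^ 4 := by
  obtain ⟨h0, h1⟩ := mulVec_mem_Icc hs u
  unfold residual
  set θ := (mobius p)⁻¹.mulVec s u
  have q : ∀ b : ℝ, (b - m) ^ 4 ≤ 8 * b ^ 4 + 8 * m ^ 4 := fun b => by
    have e1 : (b - m) ^ 2 ≤ 2 * (b ^ 2 + m ^ 2) := by nlinarith [sq_nonneg (b + m)]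
    have e2 : ((b - m) ^ 2) ^ 2 ≤ (2 * (b ^ 2 + m ^ 2)) ^ 2 :=
      pow_le_pow_left₀ (sq_nonneg _) e1 2
    nlinarith [sq_nonneg (b ^ 2 - m ^ 2)]
  have hx := q (f x)
  have hy := q (f (freeze u x x'))
  generalize f x - m = D at *
  generalize f (freeze u x x') - m = E at *
  have e1 : (D * θ - E) ^ 2 ≤ 2 * (D ^ 2 + E ^ 2) := by
    have : (D * θ) ^ 2 ≤ D ^ 2 := by
      rw [mul_pow]; exact mul_le_of_le_one_right (sq_nonneg _) (pow_le_one₀ h0 h1)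
    nlinarith [sq_nonneg (D * θ + E)]
  have e2 := mul_le_mul_of_nonneg_left e1 (sq_nonneg D)
  rw [mul_pow]
  nlinarith [sq_nonneg (D ^ 2 - E ^ 2)]

variable {μ : Fin p → Measure ℝ} [∀ i, IsProbabilityMeasure (μ i)] {f : (Fin p → ℝ) → ℝ}

/-- Centring at m instead of the mean adds the same (m − E[Y])² to the second moment and to the
covariance. -/
theorem integral_residual (hf : Measurable f) (h2 : MemLp f 2 (inputLaw μ)) (m : ℝ) (s : Vec p)
    (u : Finset (Fin p)) :
    Integrable (fun z : (Fin p → ℝ) × (Fin p → ℝ) => residual f m s u z.1 z.2)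
        ((inputLaw μ).prod (inputLaw μ)) ∧
      ∫ z : (Fin p → ℝ) × (Fin p → ℝ), residual f m s u z.1 z.2
          ∂((inputLaw μ).prod (inputLaw μ)) =
        (varY μ f + (m - meanY μ f) ^ 2) * (mobius p)⁻¹.mulVec s u -
          (closedVar μ f u + (m - meanY μ f) ^ 2) := by
  set θ := (mobius p)⁻¹.mulVec s u with hθ
  set δ := m - meanY μ f with hδ
  have hg2 := memLp_sub_meanY h2
  have hs : Integrable (fun x => (f x - meanY μ f) ^ 2) (inputLaw μ) := hg2.integrable_sq
  have hg1 : Integrable (fun x => f x - meanY μ f) (inputLaw μ) := hg2.integrable (by norm_num)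
  have j1 : Integrable (fun z : (Fin p → ℝ) × (Fin p → ℝ) => θ * (f z.1 - meanY μ f) ^ 2)
      ((inputLaw μ).prod (inputLaw μ)) :=
    (integrable_comp_measurePreserving measurePreserving_fst hs).const_mul _
  have j2 : Integrable (fun z : (Fin p → ℝ) × (Fin p → ℝ) =>
      (f z.1 - meanY μ f) * (f (freeze u z.1 z.2) - meanY μ f))
      ((inputLaw μ).prod (inputLaw μ)) := integrable_mul_freeze hg2 hg2 u
  have j3 : Integrable (fun z : (Fin p → ℝ) × (Fin p → ℝ) =>
      (δ - 2 * θ * δ) * (f z.1 - meanY μ f)) ((inputLaw μ).prod (inputLaw μ)) :=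
    (integrable_comp_measurePreserving measurePreserving_fst hg1).const_mul _
  have j4 : Integrable (fun z : (Fin p → ℝ) × (Fin p → ℝ) =>
      δ * (f (freeze u z.1 z.2) - meanY μ f)) ((inputLaw μ).prod (inputLaw μ)) :=
    (integrable_comp_measurePreserving (measurePreserving_freeze μ u) hg1).const_mul _
  have j5 : Integrable (fun _ : (Fin p → ℝ) × (Fin p → ℝ) => δ ^ 2 * (θ - 1))
      ((inputLaw μ).prod (inputLaw μ)) := integrable_const _
  have j12 : Integrable (fun z : (Fin p → ℝ) × (Fin p → ℝ) => θ * (f z.1 - meanY μ f) ^ 2 -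
      (f z.1 - meanY μ f) * (f (freeze u z.1 z.2) - meanY μ f))
      ((inputLaw μ).prod (inputLaw μ)) := j1.sub j2
  have j123 : Integrable (fun z : (Fin p → ℝ) × (Fin p → ℝ) => θ * (f z.1 - meanY μ f) ^ 2 -
      (f z.1 - meanY μ f) * (f (freeze u z.1 z.2) - meanY μ f) +
      (δ - 2 * θ * δ) * (f z.1 - meanY μ f)) ((inputLaw μ).prod (inputLaw μ)) := j12.add j3
  have j1234 : Integrable (fun z : (Fin p → ℝ) × (Fin p → ℝ) => θ * (f z.1 - meanY μ f) ^ 2 -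
      (f z.1 - meanY μ f) * (f (freeze u z.1 z.2) - meanY μ f) +
      (δ - 2 * θ * δ) * (f z.1 - meanY μ f) + δ * (f (freeze u z.1 z.2) - meanY μ f))
      ((inputLaw μ).prod (inputLaw μ)) := j123.add j4
  have e : (fun z : (Fin p → ℝ) × (Fin p → ℝ) => residual f m s u z.1 z.2) = fun z =>
      θ * (f z.1 - meanY μ f) ^ 2 -
      (f z.1 - meanY μ f) * (f (freeze u z.1 z.2) - meanY μ f) +
      (δ - 2 * θ * δ) * (f z.1 - meanY μ f) + δ * (f (freeze u z.1 z.2) - meanY μ f) +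
      δ ^ 2 * (θ - 1) := by
    funext z
    simp only [residual, ← hθ, hδ]
    ring
  rw [e]
  refine ⟨j1234.add j5, ?_⟩
  rw [integral_add j1234 j5, integral_add j123 j4, integral_add j12 j3, integral_sub j1 j2,
    integral_const_mul, integral_const_mul, integral_const_mul, ← closedVar_eq_cov hf h2,
    integral_comp_measurePreserving measurePreserving_fst hs.aestronglyMeasurable,
    integral_comp_measurePreserving measurePreserving_fst hg1.aestronglyMeasurable,
    integral_comp_measurePreserving (measurePreserving_freeze μ u) hg1.aestronglyMeasurable,
    integral_sub_meanY h2, ← varY_eq h2]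
  simp
  ring

/-- The gradient estimator is a descent direction, up to the bias of the centering. -/
theorem le_integral_residual_mul (hf : Measurable f) (h2 : MemLp f 2 (inputLaw μ))
    (hpos : 0 < varY μ f) {a : Vec p} (h0 : ∀ u, 0 ≤ a u) (h1 : ∑ u, a u = 1) (m : ℝ)
    (s : Vec p) :
    2 * (Phi μ f a s - Phi μ f a (sobolIndex μ f)) - (m - meanY μ f) ^ 2 / 4 ≤
      ∫ t : (Fin p → ℝ) × (Fin p → ℝ) × Finset (Fin p),
        residual f m s t.2.2 t.1 t.2.1 * ((mobius p)⁻¹.mulVec s t.2.2 -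
          (mobius p)⁻¹.mulVec (sobolIndex μ f) t.2.2)
        ∂((inputLaw μ).prod ((inputLaw μ).prod (subsetLaw a))) := by
  have hr := fun u => integral_residual hf h2 m s u
  rw [(integral_sampleLaw h0 h1 (F := fun u z => residual f m s u z.1 z.2 *
    ((mobius p)⁻¹.mulVec s u - (mobius p)⁻¹.mulVec (sobolIndex μ f) u))
    fun u => (hr u).1.mul_const _).2, Phi_eq hf h2 hpos a s]
  have e : 2 * (Phi μ f a (sobolIndex μ f) + varY μ f / 2 * ∑ u, a u *
      ((mobius p)⁻¹.mulVec s u - (mobius p)⁻¹.mulVec (sobolIndex μ f) u) ^ 2 -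
        Phi μ f a (sobolIndex μ f)) - (m - meanY μ f) ^ 2 / 4 =
      ∑ u, a u * (varY μ f * ((mobius p)⁻¹.mulVec s u -
        (mobius p)⁻¹.mulVec (sobolIndex μ f) u) ^ 2 - (m - meanY μ f) ^ 2 / 4) := by
    simp only [mul_sub (a _), Finset.sum_sub_distrib, ← Finset.sum_mul, h1]
    rw [add_sub_cancel_left, Finset.mul_sum, Finset.mul_sum]
    congr 1
    · exact Finset.sum_congr rfl fun u _ => by ring
    · ring
  rw [e]
  refine Finset.sum_le_sum fun u _ => mul_le_mul_of_nonneg_left ?_ (h0 u)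
  rw [integral_mul_const, (hr u).2]
  have hc : closedVar μ f u = varY μ f * (mobius p)⁻¹.mulVec (sobolIndex μ f) u := by
    rw [mobius_inv_mulVec_sobolIndex]; field_simp
  obtain ⟨c0, c1⟩ := mulVec_mem_Icc (sobolIndex_mem_simplex hf h2 hpos) u
  rw [hc]
  generalize (mobius p)⁻¹.mulVec (sobolIndex μ f) u = c at *
  generalize (mobius p)⁻¹.mulVec s u = θ
  generalize (m - meanY μ f) = δ
  -- The bias is δ²(θ − c)(θ − 1). As a quadratic in θ its second factor pair has minimum −(1 −
  -- c)²/4, at least −1/4 for c ∈ [0, 1].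
  have : 0 ≤ (θ - c) * (θ - 1) + 1 / 4 := by
    nlinarith [sq_nonneg (2 * θ - c - 1)]
  nlinarith [mul_nonneg (sq_nonneg δ) this]

end Residual

/-! ### The filtration of the samples and moments along the algorithm. -/

section Samples

variable {p : ℕ} {μ : Fin p → Measure ℝ} {f : (Fin p → ℝ) → ℝ} {a : Vec p}
  {Ω : Type*} {X X' : ℕ → Ω → Fin p → ℝ}
  {U : ℕ → Ω → Finset (Fin p)} {S₁ : Ω → Vec p}

/-- The σ-algebra generated by the samples with indices `1, …, k`. -/
abbrev past (X X' : ℕ → Ω → Fin p → ℝ) (U : ℕ → Ω → Finset (Fin p)) (k : ℕ) :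
    MeasurableSpace Ω :=
  ⨆ i ∈ Set.Iio k, MeasurableSpace.comap (fun ω => (X (i + 1) ω, X' (i + 1) ω, U (i + 1) ω))
    inferInstance

theorem measurable_past_sample {j k : ℕ} (h1 : 1 ≤ j) (hj : j ≤ k) :
    Measurable[past X X' U k] fun ω => (X j ω, X' j ω, U j ω) := by
  obtain ⟨i, rfl⟩ := Nat.exists_eq_add_of_le' h1
  refine (comap_measurable _).mono ?_ le_rfl
  exact le_iSup₂_of_le (f := fun i (_ : i ∈ Set.Iio k) => MeasurableSpace.comap
    (fun ω => (X (i + 1) ω, X' (i + 1) ω, U (i + 1) ω)) inferInstance) i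
    (Set.mem_Iio.2 (by omega)) le_rfl

theorem past_mono {j k : ℕ} (h : j ≤ k) : past X X' U j ≤ past X X' U k :=
  biSup_mono fun _ hi => lt_of_lt_of_le hi h

theorem measurable_past_empMean (hf : Measurable f) {j k : ℕ} (hj : j ≤ k) :
    Measurable[past X X' U k] (empMean f X j) := by
  unfold empMean
  refine Measurable.div_const (Finset.measurable_sum _ fun i hi => ?_) _
  rw [Finset.mem_Icc] at hi
  exact hf.comp (measurable_past_sample hi.1 (hi.2.trans hj)).fst

theorem gradEst_eq (n : ℕ) (ω : Ω) (s : Vec p) :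
    gradEst f X X' U n ω s = fun v => residual f (empMean f X n ω) s (U (n + 1) ω)
      (X (n + 1) ω) (X' (n + 1) ω) * (mobius p)⁻¹ (U (n + 1) ω) v := by
  funext v; simp only [gradEst, residual]; ring

theorem measurable_residual (hf : Measurable f) {m : MeasurableSpace Ω} {M : Ω → ℝ} {S : Ω → Vec p}
    {V : Ω → Finset (Fin p)} {Z Z' : Ω → Fin p → ℝ} (hM : Measurable M) (hS : Measurable S)
    (hV : Measurable V) (hZ : Measurable Z) (hZ' : Measurable Z') :
    Measurable fun ω => residual f (M ω) (S ω) (V ω) (Z ω) (Z' ω) := by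
  refine measurable_apply_of_finite (F := fun u ω => residual f (M ω) (S ω) u (Z ω) (Z' ω))
    (fun u => ?_) hV
  have h1 : Measurable fun ω => f (freeze u (Z ω) (Z' ω)) :=
    hf.comp ((measurable_freeze u).comp (hZ.prodMk hZ'))
  have h2 : Measurable fun ω => (mobius p)⁻¹.mulVec (S ω) u := by
    simp only [Matrix.mulVec, dotProduct]
    exact Finset.measurable_sum _ fun v _ => (measurable_pi_iff.1 hS v).const_mul _
  unfold residual
  exact ((hf.comp hZ).sub hM).mul ((((hf.comp hZ).sub hM).mul h2).sub (h1.sub hM))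

theorem iterate_succ {η : ℕ → ℝ} {k : ℕ} (hk : 1 ≤ k) (ω : Ω) :
    iterate f X X' U η S₁ (k + 1) ω = mirrorStep (η (k + 1))
      (gradEst f X X' U k ω (iterate f X X' U η S₁ k ω)) (iterate f X X' U η S₁ k ω) := by
  have : k ≠ 0 := by omega
  simp [iterate, this]

theorem iterate_one {η : ℕ → ℝ} : iterate f X X' U η S₁ 1 = S₁ := by
  funext ω; simp [iterate]

theorem iterate_mem (h0 : ∀ ω, S₁ ω ∈ openSimplex p) (η : ℕ → ℝ) {k : ℕ} (hk : 1 ≤ k) (ω : Ω) :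
    iterate f X X' U η S₁ k ω ∈ openSimplex p := by
  induction k, hk using Nat.le_induction with
  | base => rw [iterate_one]; exact h0 ω
  | succ k hk ih => rw [iterate_succ hk]; exact mirrorStep_mem ih _ _

/-- Cauchy–Schwarz twice, for the outputs and then for their squares. -/
theorem empMean_pow_four_le (k : ℕ) (hk : 1 ≤ k) (ω : Ω) :
    empMean f X k ω ^ 4 ≤ (∑ j ∈ Finset.Icc 1 k, f (X j ω) ^ 4) / k := by
  have hk0 : (0 : ℝ) < k := by exact_mod_cast hk
  have e1 := sq_sum_le_card_mul_sum_sq (s := Finset.Icc 1 k) (f := fun j => f (X j ω))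
  have e2 := sq_sum_le_card_mul_sum_sq (s := Finset.Icc 1 k) (f := fun j => f (X j ω) ^ 2)
  simp only [Nat.card_Icc, Nat.add_sub_cancel, ← pow_mul] at e1 e2
  rw [empMean, div_pow, div_le_div_iff₀ (by positivity) hk0]
  have e3 := pow_le_pow_left₀ (sq_nonneg _) e1 2
  norm_num at e2
  have e4 := mul_le_mul_of_nonneg_left e2 (sq_nonneg (k : ℝ))
  have e5 : (∑ j ∈ Finset.Icc 1 k, f (X j ω)) ^ 4 ≤
      (k : ℝ) ^ 2 * ((k : ℝ) * ∑ j ∈ Finset.Icc 1 k, f (X j ω) ^ 4) := by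
    refine le_trans (le_of_eq_of_le (by ring) e3) (le_of_eq_of_le (by ring) e4)
  nlinarith [mul_le_mul_of_nonneg_right e5 hk0.le]

theorem measurable_mirrorStep_residual (hf : Measurable f) {m : MeasurableSpace Ω} {M : Ω → ℝ}
    {S : Ω → Vec p} {V : Ω → Finset (Fin p)} {Z Z' : Ω → Fin p → ℝ} (hM : Measurable M)
    (hS : Measurable S) (hV : Measurable V) (hZ : Measurable Z) (hZ' : Measurable Z') (η : ℝ) :
    Measurable fun ω => mirrorStep η (fun v => residual f (M ω) (S ω) (V ω) (Z ω) (Z' ω) *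
      (mobius p)⁻¹ (V ω) v) (S ω) := by
  have hp : ∀ v, Measurable fun ω => S ω v * Real.exp (-η * (residual f (M ω) (S ω) (V ω) (Z ω)
      (Z' ω) * (mobius p)⁻¹ (V ω) v)) := fun v =>
    (measurable_pi_iff.1 hS v).mul (Real.measurable_exp.comp
      (((measurable_residual hf hM hS hV hZ hZ').mul
        (measurable_apply_of_finite (F := fun u _ => (mobius p)⁻¹ u v)
          (fun u => measurable_const) hV)).const_mul _))
  refine measurable_pi_iff.2 fun u => ?_
  simp only [mirrorStep]
  exact (hp u).div (Finset.measurable_sum _ fun v _ => (hp v).abs)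

variable [MeasurableSpace Ω] {P : Measure Ω}

/-- The k-th iterate uses samples 1, …, k only, which makes it independent of sample k + 1. The
initial vector may use sample 1, already contained in `past` at k = 1. -/
theorem measurable_past_iterate (h : Setting μ f a P X X' U S₁) (η : ℕ → ℝ) {k : ℕ}
    (hk : 1 ≤ k) : Measurable[past X X' U k] (iterate f X X' U η S₁ k) := by
  induction k, hk using Nat.le_induction with
  | base =>
    rw [iterate_one]
    exact h.init_measurable.mono (measurable_past_sample le_rfl le_rfl).comap_le le_rfl
  | succ k hk ih =>
    have hS := ih.mono (past_mono (Nat.le_succ k)) le_rfl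
    have hs := measurable_past_sample (X := X) (X' := X') (U := U) (Nat.le_add_left 1 k) le_rfl
    have := measurable_mirrorStep_residual h.measurable_f
      (measurable_past_empMean (X' := X') (U := U) h.measurable_f (Nat.le_succ k)) hS
      hs.snd.snd hs.fst hs.snd.fst (η (k + 1))
    convert this using 2 with ω
    rw [iterate_succ hk, gradEst_eq]

theorem Setting.past_le (h : Setting μ f a P X X' U S₁) (k : ℕ) :
    past X X' U k ≤ (inferInstance : MeasurableSpace Ω) :=
  iSup₂_le fun i _ => (h.measurable_sample (i + 1) (Nat.le_add_left 1 i)).comap_le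

theorem Setting.indepFun_past (h : Setting μ f a P X X' U S₁) {β : Type*} [MeasurableSpace β]
    {k : ℕ} {W : Ω → β}
    (hW : Measurable[past X X' U k] W) :
    IndepFun W (fun ω => (X (k + 1) ω, X' (k + 1) ω, U (k + 1) ω)) P := by
  have := indep_iSup_of_disjoint
    (fun i => (h.measurable_sample (i + 1) (Nat.le_add_left 1 i)).comap_le) h.indep_sample.iIndep
    (S := Set.Iio k) (T := {k}) (by simp)
  simp only [Set.mem_singleton_iff, iSup_iSup_eq_left] at this
  exact indep_of_indep_of_le_left this hW.comap_le

theorem Setting.measurePreserving_sample (h : Setting μ f a P X X' U S₁) {k : ℕ} (hk : 1 ≤ k) :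
    MeasurePreserving (fun ω => (X k ω, X' k ω, U k ω)) P
      ((inputLaw μ).prod ((inputLaw μ).prod (subsetLaw a))) :=
  ⟨h.measurable_sample k hk, h.law_sample k hk⟩

theorem Setting.measurePreserving_input (h : Setting μ f a P X X' U S₁) {k : ℕ} (hk : 1 ≤ k) :
    MeasurePreserving (X k) P (inputLaw μ) := by
  have := h.isProb_input
  have := isProbabilityMeasure_subsetLaw h.weight_nonneg h.weight_sum
  exact measurePreserving_fst.comp (h.measurePreserving_sample hk)

theorem Setting.memLp_two (h : Setting μ f a P X X' U S₁) : MemLp f 2 (inputLaw μ) := by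
  have := h.isProb_input
  rw [memLp_two_iff_integrable_sq h.measurable_f.aestronglyMeasurable]
  refine Integrable.mono' ((integrable_const (1 : ℝ)).add h.integrable_pow_four)
    (h.measurable_f.pow_const 2).aestronglyMeasurable (Filter.Eventually.of_forall fun x => ?_)
  rw [Real.norm_of_nonneg (sq_nonneg _)]
  simp only [Pi.add_apply]
  nlinarith [sq_nonneg (f x ^ 2 - 1)]

theorem fourthMoment_nonneg (μ : Fin p → Measure ℝ) (f : (Fin p → ℝ) → ℝ) :
    0 ≤ fourthMoment μ f :=
  integral_nonneg fun x => by positivity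

/-- From y² ≤ 1 + y⁴. It serves for decreasing steps, where the final bound does not contain the
variance. -/
theorem Setting.varY_le (h : Setting μ f a P X X' U S₁) : varY μ f ≤ 1 + fourthMoment μ f := by
  have := h.isProb_input
  have h2 := h.memLp_two
  have e1 : varY μ f ≤ ∫ x, f x ^ 2 ∂(inputLaw μ) := by
    rw [varY, variance_eq_sub h2]
    simp only [Pi.pow_apply]
    linarith [sq_nonneg (∫ x, f x ∂(inputLaw μ))]
  have e2 : ∫ x, f x ^ 2 ∂(inputLaw μ) ≤ ∫ x, (1 + f x ^ 4) ∂(inputLaw μ) :=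
    integral_mono h2.integrable_sq ((integrable_const _).add h.integrable_pow_four)
      fun x => by dsimp only; nlinarith [sq_nonneg (f x ^ 2 - 1)]
  rw [integral_add (integrable_const _) h.integrable_pow_four] at e2
  simp only [integral_const, probReal_univ, smul_eq_mul, mul_one] at e2
  exact e1.trans e2

theorem Setting.integral_output_pow_four (h : Setting μ f a P X X' U S₁) {k : ℕ} (hk : 1 ≤ k) :
    Integrable (fun ω => f (X k ω) ^ 4) P ∧ ∫ ω, f (X k ω) ^ 4 ∂P = fourthMoment μ f :=
  ⟨integrable_comp_measurePreserving (h.measurePreserving_input hk) h.integrable_pow_four,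
    integral_comp_measurePreserving (h.measurePreserving_input hk)
      h.integrable_pow_four.aestronglyMeasurable⟩

theorem Setting.integral_frozen_pow_four (h : Setting μ f a P X X' U S₁) {k : ℕ} (hk : 1 ≤ k) :
    Integrable (fun ω => f (freeze (U k ω) (X k ω) (X' k ω)) ^ 4) P ∧
      ∫ ω, f (freeze (U k ω) (X k ω) (X' k ω)) ^ 4 ∂P = fourthMoment μ f := by
  have := h.isProb_input
  have hs := integral_sampleLaw h.weight_nonneg h.weight_sum (μ := μ)
    (F := fun u z => f (freeze u z.1 z.2) ^ 4) fun u =>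
      integrable_comp_measurePreserving (measurePreserving_freeze μ u) h.integrable_pow_four
  have hmp := h.measurePreserving_sample hk
  refine ⟨integrable_comp_measurePreserving hmp hs.1, ?_⟩
  have e := integral_comp_measurePreserving hmp hs.1.aestronglyMeasurable
  rw [hs.2] at e
  refine e.trans ?_
  have e4 : ∀ u, ∫ z : (Fin p → ℝ) × (Fin p → ℝ), f (freeze u z.1 z.2) ^ 4
      ∂((inputLaw μ).prod (inputLaw μ)) = fourthMoment μ f := fun u =>
    integral_comp_measurePreserving (measurePreserving_freeze μ u)
      h.integrable_pow_four.aestronglyMeasurable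
  simp only [e4, ← Finset.sum_mul, h.weight_sum, one_mul]

theorem Setting.measurable_empMean (h : Setting μ f a P X X' U S₁) (k : ℕ) :
    Measurable (empMean f X k) :=
  (measurable_past_empMean (X' := X') (U := U) h.measurable_f le_rfl).mono (h.past_le k) le_rfl

theorem Setting.integral_empMean_pow_four (h : Setting μ f a P X X' U S₁) {k : ℕ} (hk : 1 ≤ k) :
    Integrable (fun ω => empMean f X k ω ^ 4) P ∧
      ∫ ω, empMean f X k ω ^ 4 ∂P ≤ fourthMoment μ f := by
  have hj : ∀ j ∈ Finset.Icc 1 k, Integrable (fun ω => f (X j ω) ^ 4) P := fun j hj =>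
    (h.integral_output_pow_four (Finset.mem_Icc.1 hj).1).1
  have hs : Integrable (fun ω => (∑ j ∈ Finset.Icc 1 k, f (X j ω) ^ 4) / k) P :=
    (integrable_finsetSum _ hj).div_const _
  have hi : Integrable (fun ω => empMean f X k ω ^ 4) P :=
    hs.mono' ((h.measurable_empMean k).pow_const 4).aestronglyMeasurable
      (Filter.Eventually.of_forall fun ω => by
        rw [Real.norm_of_nonneg (by positivity)]; exact empMean_pow_four_le k hk ω)
  refine ⟨hi, (integral_mono hi hs (empMean_pow_four_le k hk)).trans (le_of_eq ?_)⟩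
  rw [integral_div, integral_finsetSum _ hj, Finset.sum_congr rfl fun j hj =>
    (h.integral_output_pow_four (Finset.mem_Icc.1 hj).1).2]
  have : (k : ℝ) ≠ 0 := by positivity
  simp [this]

theorem Setting.memLp_output (h : Setting μ f a P X X' U S₁) {k : ℕ} (hk : 1 ≤ k) :
    MemLp (fun ω => f (X k ω)) 2 P :=
  h.memLp_two.comp_measurePreserving (h.measurePreserving_input hk)

theorem Setting.integral_empMean_sub_sq (h : Setting μ f a P X X' U S₁) {k : ℕ} (hk : 1 ≤ k) :
    Integrable (fun ω => (empMean f X k ω - meanY μ f) ^ 2) P ∧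
      ∫ ω, (empMean f X k ω - meanY μ f) ^ 2 ∂P = varY μ f / k := by
  have := h.isProb
  have hk0 : (k : ℝ) ≠ 0 := by positivity
  have hL : ∀ j ∈ Finset.Icc 1 k, MemLp (fun ω => f (X j ω)) 2 P := fun j hj =>
    h.memLp_output (Finset.mem_Icc.1 hj).1
  have e : empMean f X k = fun ω => (k : ℝ)⁻¹ * (∑ j ∈ Finset.Icc 1 k, fun ω => f (X j ω)) ω := by
    funext ω; simp [empMean]; ring
  have hm : MemLp (empMean f X k) 2 P := by
    rw [e]; exact (memLp_finsetSum' _ hL).const_mul _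
  have hmean : ∫ ω, empMean f X k ω ∂P = meanY μ f := by
    simp only [empMean]
    rw [integral_div, integral_finsetSum _ fun j hj => (hL j hj).integrable (by norm_num),
      Finset.sum_congr rfl fun j hj => integral_comp_measurePreserving
        (h.measurePreserving_input (Finset.mem_Icc.1 hj).1) h.measurable_f.aestronglyMeasurable]
    simp [hk0, meanY]
  refine ⟨(hm.sub (memLp_const _)).integrable_sq, ?_⟩
  have hv := variance_eq_integral hm.aestronglyMeasurable.aemeasurable
  rw [hmean] at hv
  rw [← hv, e, variance_const_mul, IndepFun.variance_sum hL]
  · have : ∀ j ∈ Finset.Icc 1 k, Var[fun ω => f (X j ω); P] = varY μ f := by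
      intro j hj
      have hj1 := (Finset.mem_Icc.1 hj).1
      rw [varY_eq h.memLp_two, variance_eq_integral
        (h.memLp_output hj1).aestronglyMeasurable.aemeasurable,
        integral_comp_measurePreserving (h.measurePreserving_input hj1)
          h.measurable_f.aestronglyMeasurable]
      exact integral_comp_measurePreserving (h.measurePreserving_input hj1)
        ((h.measurable_f.sub_const _).pow_const 2).aestronglyMeasurable
    rw [Finset.sum_congr rfl this]
    simp
    field_simp
  · intro i hi j hj hij
    simp only [Finset.coe_Icc, Set.mem_Icc] at hi hj
    -- Samples are numbered from 1, the independent family from 0.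
    obtain ⟨i, rfl⟩ := Nat.exists_eq_add_of_le' hi.1
    obtain ⟨j, rfl⟩ := Nat.exists_eq_add_of_le' hj.1
    have := h.indep_sample.indepFun (i := i) (j := j) (by omega)
    exact this.comp (h.measurable_f.comp measurable_fst) (h.measurable_f.comp measurable_fst)

end Samples

/-! ### From pathwise regret to expected risk. -/

section Risk

variable {p : ℕ} {μ : Fin p → Measure ℝ} {f : (Fin p → ℝ) → ℝ} {a : Vec p}
  {Ω : Type*} {X X' : ℕ → Ω → Fin p → ℝ} {U : ℕ → Ω → Finset (Fin p)} {S₁ : Ω → Vec p}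

/-- The residual drawn at step `k + 1` of the algorithm. -/
noncomputable def stepResidual (f : (Fin p → ℝ) → ℝ) (X X' : ℕ → Ω → Fin p → ℝ)
    (U : ℕ → Ω → Finset (Fin p)) (η : ℕ → ℝ) (S₁ : Ω → Vec p) (k : ℕ) (ω : Ω) : ℝ :=
  residual f (empMean f X k ω) (iterate f X X' U η S₁ k ω) (U (k + 1) ω) (X (k + 1) ω)
    (X' (k + 1) ω)

/-- The residual times the error of the current iterate at the drawn subset: the scalar product of
the gradient estimator and the error. -/
noncomputable def stepProduct (μ : Fin p → Measure ℝ) (f : (Fin p → ℝ) → ℝ)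
    (X X' : ℕ → Ω → Fin p → ℝ) (U : ℕ → Ω → Finset (Fin p)) (η : ℕ → ℝ) (S₁ : Ω → Vec p) (k : ℕ)
    (ω : Ω) : ℝ :=
  stepResidual f X X' U η S₁ k ω *
    ((mobius p)⁻¹.mulVec (iterate f X X' U η S₁ k ω) (U (k + 1) ω) -
      (mobius p)⁻¹.mulVec (sobolIndex μ f) (U (k + 1) ω))

/-- Pathwise regret bound. -/
theorem sum_stepProduct_le (h0 : ∀ ω, S₁ ω ∈ openSimplex p)
    (hS : sobolIndex μ f ∈ simplex p) (η : ℕ → ℝ) (n : ℕ) (ω : Ω) :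
    ∑ k ∈ Finset.Icc 1 n, η (k + 1) * stepProduct μ f X X' U η S₁ k ω ≤
      bregman (sobolIndex μ f) (S₁ ω) +
        ∑ k ∈ Finset.Icc 1 n, η (k + 1) ^ 2 * stepResidual f X X' U η S₁ k ω ^ 2 := by
  -- The divergence to the last iterate stays on the left so that the induction telescopes; being
  -- nonnegative, it is dropped afterwards.
  have key : ∑ k ∈ Finset.Icc 1 n, η (k + 1) * stepProduct μ f X X' U η S₁ k ω +
      bregman (sobolIndex μ f) (iterate f X X' U η S₁ (n + 1) ω) ≤
      bregman (sobolIndex μ f) (S₁ ω) +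
        ∑ k ∈ Finset.Icc 1 n, η (k + 1) ^ 2 * stepResidual f X X' U η S₁ k ω ^ 2 := by
    induction n with
    | zero => simp [iterate_one]
    | succ n ih =>
      rw [Finset.sum_Icc_succ_top (by omega), Finset.sum_Icc_succ_top (by omega),
        iterate_succ (Nat.le_add_left 1 n), gradEst_eq]
      have := bregman_mirrorStep_le hS (iterate_mem (f := f) (X := X) (X' := X') (U := U) h0 η
        (Nat.le_add_left 1 n) ω) (η (n + 1 + 1))
        (stepResidual f X X' U η S₁ (n + 1) ω) (U (n + 1 + 1) ω)
      simp only [stepProduct, stepResidual] at *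
      linarith
  have := bregman_nonneg hS (iterate_mem (f := f) (X := X) (X' := X') (U := U) h0 η
    (Nat.le_add_left 1 n) ω)
  linarith

theorem measurable_Phi [∀ i, IsProbabilityMeasure (μ i)] (hf : Measurable f)
    (h2 : MemLp f 2 (inputLaw μ)) (hpos : 0 < varY μ f) (a : Vec p) :
    Measurable (Phi μ f a) := by
  have : Phi μ f a = fun s => _ := funext fun s => Phi_eq hf h2 hpos a s
  rw [this]
  simp only [Matrix.mulVec, dotProduct]
  fun_prop

theorem Phi_sub_nonneg [∀ i, IsProbabilityMeasure (μ i)] (hf : Measurable f)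
    (h2 : MemLp f 2 (inputLaw μ)) (hpos : 0 < varY μ f) (ha : ∀ u, 0 ≤ a u) (s : Vec p) :
    0 ≤ Phi μ f a s - Phi μ f a (sobolIndex μ f) := by
  rw [Phi_eq hf h2 hpos a s, add_sub_cancel_left]
  exact mul_nonneg (by linarith) (Finset.sum_nonneg fun u _ => mul_nonneg (ha u) (sq_nonneg _))

theorem Phi_sub_le [∀ i, IsProbabilityMeasure (μ i)] (hf : Measurable f)
    (h2 : MemLp f 2 (inputLaw μ)) (hpos : 0 < varY μ f) (ha : ∀ u, 0 ≤ a u) (h1 : ∑ u, a u = 1)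
    {s : Vec p} (hs : s ∈ simplex p) :
    Phi μ f a s - Phi μ f a (sobolIndex μ f) ≤ varY μ f / 2 := by
  rw [Phi_eq hf h2 hpos a s, add_sub_cancel_left]
  refine mul_le_of_le_one_right (by linarith) ?_
  rw [← h1]
  refine Finset.sum_le_sum fun u _ => mul_le_of_le_one_right (ha u) ?_
  obtain ⟨l1, l2⟩ := mulVec_mem_Icc hs u
  obtain ⟨l3, l4⟩ := mulVec_mem_Icc (sobolIndex_mem_simplex hf h2 hpos) u
  rw [sq_le_one_iff_abs_le_one, abs_le]
  constructor <;> linarith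

/-- Convexity of the objective, along a weighted average. -/
theorem Phi_cesaro_sub_le [∀ i, IsProbabilityMeasure (μ i)] (hf : Measurable f)
    (h2 : MemLp f 2 (inputLaw μ)) (hpos : 0 < varY μ f) (ha : ∀ u, 0 ≤ a u) {η : ℕ → ℝ}
    (hη : ∀ j, 0 ≤ η j) {n : ℕ} (hE : 0 < ∑ k ∈ Finset.Icc 1 n, η (k + 1)) (S : ℕ → Ω → Vec p)
    (ω : Ω) :
    Phi μ f a (cesaro η S n ω) - Phi μ f a (sobolIndex μ f) ≤
      (∑ k ∈ Finset.Icc 1 n, η (k + 1))⁻¹ * ∑ k ∈ Finset.Icc 1 n,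
        η (k + 1) * (Phi μ f a (S k ω) - Phi μ f a (sobolIndex μ f)) := by
  set E := ∑ k ∈ Finset.Icc 1 n, η (k + 1) with hEdef
  set c := (mobius p)⁻¹.mulVec (sobolIndex μ f) with hc
  have hlin : ∀ u, (mobius p)⁻¹.mulVec (cesaro η S n ω) u - c u =
      ∑ k ∈ Finset.Icc 1 n, (E⁻¹ * η (k + 1)) * ((mobius p)⁻¹.mulVec (S k ω) u - c u) := by
    intro u
    have e1 : (mobius p)⁻¹.mulVec (cesaro η S n ω) u =
        E⁻¹ * ∑ k ∈ Finset.Icc 1 n, η (k + 1) * (mobius p)⁻¹.mulVec (S k ω) u := by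
      rw [cesaro, Matrix.mulVec_smul, Matrix.mulVec_sum]
      simp only [Matrix.mulVec_smul, Finset.sum_apply, Pi.smul_apply, smul_eq_mul, ← hEdef]
    have e2 : c u = E⁻¹ * ∑ k ∈ Finset.Icc 1 n, η (k + 1) * c u := by
      rw [← Finset.sum_mul, ← hEdef, inv_mul_cancel_left₀ hE.ne']
    rw [e1]
    nth_rw 1 [e2]
    rw [← mul_sub, ← Finset.sum_sub_distrib, Finset.mul_sum]
    exact Finset.sum_congr rfl fun k _ => by ring
  have hsq : ∀ u, ((mobius p)⁻¹.mulVec (cesaro η S n ω) u - c u) ^ 2 ≤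
      ∑ k ∈ Finset.Icc 1 n, (E⁻¹ * η (k + 1)) * ((mobius p)⁻¹.mulVec (S k ω) u - c u) ^ 2 := by
    intro u
    rw [hlin]
    refine Real.pow_arith_mean_le_arith_mean_pow_of_even _ _ _
      (fun k _ => mul_nonneg (inv_nonneg.2 hE.le) (hη _)) ?_ even_two
    rw [← Finset.mul_sum, ← hEdef, inv_mul_cancel₀ hE.ne']
  simp only [Phi_eq hf h2 hpos a (cesaro η S n ω), Phi_eq hf h2 hpos a (S _ ω),
    add_sub_cancel_left, ← hc]
  calc _ ≤ varY μ f / 2 * ∑ u, a u * ∑ k ∈ Finset.Icc 1 n, (E⁻¹ * η (k + 1)) *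
        ((mobius p)⁻¹.mulVec (S k ω) u - c u) ^ 2 :=
        mul_le_mul_of_nonneg_left (Finset.sum_le_sum fun u _ =>
          mul_le_mul_of_nonneg_left (hsq u) (ha u)) (by linarith)
    _ = _ := by
      simp only [Finset.mul_sum]
      rw [Finset.sum_comm]
      exact Finset.sum_congr rfl fun k _ => Finset.sum_congr rfl fun u _ => by ring

variable [MeasurableSpace Ω] {P : Measure Ω}

theorem Setting.sobolIndex_mem (h : Setting μ f a P X X' U S₁) : sobolIndex μ f ∈ simplex p := by
  have := h.isProb_input
  exact sobolIndex_mem_simplex h.measurable_f h.memLp_two h.varY_pos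

theorem Setting.measurable_iterate (h : Setting μ f a P X X' U S₁) (η : ℕ → ℝ) {k : ℕ}
    (hk : 1 ≤ k) : Measurable (iterate f X X' U η S₁ k) :=
  (measurable_past_iterate h η hk).mono (h.past_le k) le_rfl

theorem Setting.measurable_stepResidual (h : Setting μ f a P X X' U S₁) (η : ℕ → ℝ) {k : ℕ}
    (hk : 1 ≤ k) : Measurable (stepResidual f X X' U η S₁ k) := by
  have hs := h.measurable_sample (k + 1) (Nat.le_add_left 1 k)
  exact measurable_residual h.measurable_f (h.measurable_empMean k) (h.measurable_iterate η hk)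
    hs.snd.snd hs.fst hs.snd.fst

theorem Setting.integral_stepResidual_sq (h : Setting μ f a P X X' U S₁) (η : ℕ → ℝ) {k : ℕ}
    (hk : 1 ≤ k) :
    Integrable (fun ω => stepResidual f X X' U η S₁ k ω ^ 2) P ∧
      ∫ ω, stepResidual f X X' U η S₁ k ω ^ 2 ∂P ≤ 64 * fourthMoment μ f := by
  obtain ⟨i1, e1⟩ := h.integral_output_pow_four (Nat.le_add_left 1 k)
  obtain ⟨i2, e2⟩ := h.integral_frozen_pow_four (Nat.le_add_left 1 k)
  obtain ⟨i3, e3⟩ := h.integral_empMean_pow_four hk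
  have j12 : Integrable (fun ω => 24 * f (X (k + 1) ω) ^ 4 +
      8 * f (freeze (U (k + 1) ω) (X (k + 1) ω) (X' (k + 1) ω)) ^ 4) P :=
    (i1.const_mul 24).add (i2.const_mul 8)
  have j : Integrable (fun ω => 24 * f (X (k + 1) ω) ^ 4 +
      8 * f (freeze (U (k + 1) ω) (X (k + 1) ω) (X' (k + 1) ω)) ^ 4 +
      32 * empMean f X k ω ^ 4) P := j12.add (i3.const_mul 32)
  have hle := fun ω => residual_sq_le (f := f) (m := empMean f X k ω)
    (iterate_mem (f := f) (X := X) (X' := X') (U := U) h.init_mem η hk ω).1 (U (k + 1) ω)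
    (X (k + 1) ω) (X' (k + 1) ω)
  have hi : Integrable (fun ω => stepResidual f X X' U η S₁ k ω ^ 2) P :=
    j.mono' ((h.measurable_stepResidual η hk).pow_const 2).aestronglyMeasurable
      (Filter.Eventually.of_forall fun ω => by
        rw [Real.norm_of_nonneg (sq_nonneg _)]; exact hle ω)
  refine ⟨hi, (integral_mono hi j hle).trans ?_⟩
  rw [integral_add j12 (i3.const_mul 32), integral_add (i1.const_mul 24) (i2.const_mul 8),
    integral_const_mul, integral_const_mul, integral_const_mul, e1, e2]
  linarith

theorem Setting.integrable_Phi (h : Setting μ f a P X X' U S₁) (η : ℕ → ℝ) {k : ℕ}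
    (hk : 1 ≤ k) : Integrable (fun ω => Phi μ f a (iterate f X X' U η S₁ k ω) -
      Phi μ f a (sobolIndex μ f)) P := by
  have := h.isProb_input
  have := h.isProb
  have hL := h.memLp_two
  refine Integrable.mono' (integrable_const (varY μ f / 2))
    (((measurable_Phi h.measurable_f hL h.varY_pos a).comp
      (h.measurable_iterate η hk)).sub_const _).aestronglyMeasurable
    (Filter.Eventually.of_forall fun ω => ?_)
  rw [Real.norm_of_nonneg (Phi_sub_nonneg h.measurable_f hL h.varY_pos h.weight_nonneg _)]
  exact Phi_sub_le h.measurable_f hL h.varY_pos h.weight_nonneg h.weight_sum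
    (iterate_mem h.init_mem η hk ω).1

theorem Setting.le_integral_stepProduct (h : Setting μ f a P X X' U S₁) (η : ℕ → ℝ) {k : ℕ}
    (hk : 1 ≤ k) :
    Integrable (stepProduct μ f X X' U η S₁ k) P ∧
      2 * ∫ ω, (Phi μ f a (iterate f X X' U η S₁ k ω) - Phi μ f a (sobolIndex μ f)) ∂P -
        varY μ f / (4 * k) ≤ ∫ ω, stepProduct μ f X X' U η S₁ k ω ∂P := by
  have := h.isProb_input
  have := h.isProb
  have := isProbabilityMeasure_subsetLaw h.weight_nonneg h.weight_sum
  have hL := h.memLp_two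
  set W : Ω → ℝ × Vec p := fun ω => (empMean f X k ω, iterate f X X' U η S₁ k ω) with hW
  set ξ := fun ω => (X (k + 1) ω, X' (k + 1) ω, U (k + 1) ω) with hξ
  set ν := (inputLaw μ).prod ((inputLaw μ).prod (subsetLaw a)) with hν
  have hWp : Measurable[past X X' U k] W :=
    (measurable_past_empMean h.measurable_f le_rfl).prodMk (measurable_past_iterate h η hk)
  have hWm : Measurable W := hWp.mono (h.past_le k) le_rfl
  have hξm : MeasurePreserving ξ P ν := h.measurePreserving_sample (Nat.le_add_left 1 k)
  -- The state is a function of the past, hence independent of the next sample: Fubini on this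
  -- product law replaces conditioning.
  have hlaw : P.map (fun ω => (W ω, ξ ω)) = (P.map W).prod ν := by
    rw [(indepFun_iff_map_prod_eq_prod_map_map hWm.aemeasurable hξm.measurable.aemeasurable).1
      (h.indepFun_past hWp), hξm.map_eq]
  set F : (ℝ × Vec p) × ((Fin p → ℝ) × (Fin p → ℝ) × Finset (Fin p)) → ℝ := fun t =>
    residual f t.1.1 t.1.2 t.2.2.2 t.2.1 t.2.2.1 * ((mobius p)⁻¹.mulVec t.1.2 t.2.2.2 -
      (mobius p)⁻¹.mulVec (sobolIndex μ f) t.2.2.2) with hF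
  have hFm : Measurable F := by
    refine (measurable_residual h.measurable_f measurable_fst.fst measurable_fst.snd
      measurable_snd.snd.snd measurable_snd.fst measurable_snd.snd.fst).mul
      (measurable_apply_of_finite (F := fun u (t : (ℝ × Vec p) × ((Fin p → ℝ) × (Fin p → ℝ) ×
        Finset (Fin p))) => (mobius p)⁻¹.mulVec t.1.2 u - (mobius p)⁻¹.mulVec (sobolIndex μ f) u)
        (fun u => ?_) measurable_snd.snd.snd)
    simp only [Matrix.mulVec, dotProduct]
    fun_prop
  have hint : Integrable (stepProduct μ f X X' U η S₁ k) P := by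
    -- The error at a subset is at most 1 in absolute value, and |r| ≤ 1 + r² for the residual r.
    refine Integrable.mono' ((integrable_const (1 : ℝ)).add (h.integral_stepResidual_sq η hk).1)
      (hFm.comp (hWm.prodMk hξm.measurable)).aestronglyMeasurable
      (Filter.Eventually.of_forall fun ω => ?_)
    obtain ⟨l1, l2⟩ := mulVec_mem_Icc
      (iterate_mem (f := f) (X := X) (X' := X') (U := U) h.init_mem η hk ω).1 (U (k + 1) ω)
    obtain ⟨l3, l4⟩ := mulVec_mem_Icc h.sobolIndex_mem (U (k + 1) ω)
    have hd : |(mobius p)⁻¹.mulVec (iterate f X X' U η S₁ k ω) (U (k + 1) ω) -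
        (mobius p)⁻¹.mulVec (sobolIndex μ f) (U (k + 1) ω)| ≤ 1 := by
      rw [abs_le]; constructor <;> linarith
    rw [Real.norm_eq_abs, stepProduct, abs_mul]
    refine (mul_le_of_le_one_right (abs_nonneg _) hd).trans ?_
    simp only [Pi.add_apply]
    nlinarith [sq_abs (stepResidual f X X' U η S₁ k ω),
      sq_nonneg (|stepResidual f X X' U η S₁ k ω| - 1)]
  refine ⟨hint, ?_⟩
  have hWξ : MeasurePreserving (fun ω => (W ω, ξ ω)) P ((P.map W).prod ν) :=
    ⟨hWm.prodMk hξm.measurable, hlaw⟩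
  have hFi : Integrable F ((P.map W).prod ν) := by
    rw [← hlaw, integrable_map_measure hFm.aestronglyMeasurable
      (hWm.prodMk hξm.measurable).aemeasurable]
    exact hint
  have : IsProbabilityMeasure (P.map W) := Measure.isProbabilityMeasure_map hWm.aemeasurable
  have e1 : ∫ ω, stepProduct μ f X X' U η S₁ k ω ∂P = ∫ ω, ∫ t, F (W ω, t) ∂ν ∂P := by
    have := integral_comp_measurePreserving hWξ hFm.aestronglyMeasurable
    rw [integral_prod _ hFi, integral_map hWm.aemeasurable
      hFm.stronglyMeasurable.integral_prod_right'.aestronglyMeasurable] at this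
    exact this
  obtain ⟨i1, e2⟩ := h.integral_empMean_sub_sq hk
  have i2 := h.integrable_Phi η hk
  have i3 : Integrable (fun ω => ∫ t, F (W ω, t) ∂ν) P := by
    have := hFi.integral_prod_left
    exact (integrable_map_measure
      hFm.stronglyMeasurable.integral_prod_right'.aestronglyMeasurable hWm.aemeasurable).1 this
  have hle := integral_mono ((i2.const_mul 2).sub (i1.div_const 4)) i3 fun ω =>
    le_integral_residual_mul h.measurable_f hL h.varY_pos h.weight_nonneg h.weight_sum
      (empMean f X k ω) (iterate f X X' U η S₁ k ω)
  rw [e1]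
  refine le_trans (le_of_eq ?_) hle
  simp only [Pi.sub_apply]
  rw [integral_sub (i2.const_mul 2) (i1.div_const 4), integral_const_mul, integral_div, e2,
    div_div, mul_comm (4 : ℝ)]

/-- Risk bound for the weighted average of the iterates, for general nonnegative steps. -/
theorem Setting.riskBound_cesaro (h : Setting μ f a P X X' U S₁) {η : ℕ → ℝ}
    (hη : ∀ j, 0 ≤ η j) {n : ℕ} (hE : 0 < ∑ k ∈ Finset.Icc 1 n, η (k + 1)) {B : ℝ}
    (hB : (∫ ω, bregman (sobolIndex μ f) (S₁ ω) ∂P) +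
        varY μ f / 4 * (∑ k ∈ Finset.Icc 1 n, η (k + 1) / k) +
        64 * fourthMoment μ f * (∑ k ∈ Finset.Icc 1 n, η (k + 1) ^ 2) ≤
      2 * (∑ k ∈ Finset.Icc 1 n, η (k + 1)) * B) :
    RiskBound μ f a P (cesaro η (iterate f X X' U η S₁) n) B := by
  have := h.isProb_input
  have := h.isProb
  have hL := h.memLp_two
  set E := ∑ k ∈ Finset.Icc 1 n, η (k + 1) with hEdef
  have h1 : ∀ k ∈ Finset.Icc 1 n, 1 ≤ k := fun k hk => (Finset.mem_Icc.1 hk).1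
  set R : ℕ → Ω → ℝ := fun k ω => Phi μ f a (iterate f X X' U η S₁ k ω) -
    Phi μ f a (sobolIndex μ f) with hR
  have iR : ∀ k ∈ Finset.Icc 1 n, Integrable (fun ω => η (k + 1) * R k ω) P := fun k hk =>
    (h.integrable_Phi η (h1 k hk)).const_mul _
  have iS : Integrable (fun ω => E⁻¹ * ∑ k ∈ Finset.Icc 1 n, η (k + 1) * R k ω) P :=
    (integrable_finsetSum _ iR).const_mul _
  have hcm : Measurable (cesaro η (iterate f X X' U η S₁) n) := by
    refine measurable_pi_iff.2 fun u => ?_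
    simp only [cesaro, Pi.smul_apply, Finset.sum_apply, smul_eq_mul]
    exact (Finset.measurable_sum _ fun k hk =>
      (measurable_pi_iff.1 (h.measurable_iterate η (h1 k hk)) u).const_mul _).const_mul _
  have hle := Phi_cesaro_sub_le h.measurable_f hL h.varY_pos h.weight_nonneg hη hE
    (iterate f X X' U η S₁)
  have i0 : Integrable (fun ω => Phi μ f a (cesaro η (iterate f X X' U η S₁) n ω) -
      Phi μ f a (sobolIndex μ f)) P := by
    refine iS.mono' (((measurable_Phi h.measurable_f hL h.varY_pos a).comp hcm).sub_const
      _).aestronglyMeasurable (Filter.Eventually.of_forall fun ω => ?_)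
    rw [Real.norm_of_nonneg (Phi_sub_nonneg h.measurable_f hL h.varY_pos h.weight_nonneg _)]
    exact hle ω
  have i0' : Integrable (fun ω => Phi μ f a (cesaro η (iterate f X X' U η S₁) n ω)) P :=
    (i0.add (integrable_const (Phi μ f a (sobolIndex μ f)))).congr
      (Filter.Eventually.of_forall fun ω => sub_add_cancel _ _)
  refine ⟨i0', _, isLeast_Phi h.measurable_f hL h.varY_pos h.weight_nonneg, ?_⟩
  have e0 := integral_sub i0' (integrable_const (Phi μ f a (sobolIndex μ f)))
  simp only [integral_const, probReal_univ, smul_eq_mul, one_mul] at e0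
  rw [← e0]
  have iP : ∀ k ∈ Finset.Icc 1 n, Integrable (fun ω => η (k + 1) *
      stepProduct μ f X X' U η S₁ k ω) P := fun k hk =>
    (h.le_integral_stepProduct η (h1 k hk)).1.const_mul _
  have iQ : ∀ k ∈ Finset.Icc 1 n, Integrable (fun ω => η (k + 1) ^ 2 *
      stepResidual f X X' U η S₁ k ω ^ 2) P := fun k hk =>
    (h.integral_stepResidual_sq η (h1 k hk)).1.const_mul _
  -- Expected regret. Below, `b1` bounds the second-order terms, `b2` bounds the linear terms from
  -- below, and `b3` is convexity of the objective.
  have hreg := integral_mono (integrable_finsetSum _ iP)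
    (h.init_integrable.add (integrable_finsetSum _ iQ))
    (sum_stepProduct_le h.init_mem h.sobolIndex_mem η n)
  simp only [Pi.add_apply] at hreg
  rw [integral_add h.init_integrable (integrable_finsetSum _ iQ), integral_finsetSum _ iP,
    integral_finsetSum _ iQ] at hreg
  simp only [integral_const_mul] at hreg
  have b1 : ∑ k ∈ Finset.Icc 1 n, η (k + 1) ^ 2 *
      ∫ ω, stepResidual f X X' U η S₁ k ω ^ 2 ∂P ≤
      64 * fourthMoment μ f * ∑ k ∈ Finset.Icc 1 n, η (k + 1) ^ 2 := by
    rw [Finset.mul_sum]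
    refine Finset.sum_le_sum fun k hk => ?_
    rw [mul_comm]
    exact mul_le_mul_of_nonneg_right (h.integral_stepResidual_sq η (h1 k hk)).2 (sq_nonneg _)
  have b2 : 2 * ∑ k ∈ Finset.Icc 1 n, η (k + 1) * ∫ ω, R k ω ∂P -
      varY μ f / 4 * (∑ k ∈ Finset.Icc 1 n, η (k + 1) / k) ≤
      ∑ k ∈ Finset.Icc 1 n, η (k + 1) * ∫ ω, stepProduct μ f X X' U η S₁ k ω ∂P := by
    rw [Finset.mul_sum, Finset.mul_sum, ← Finset.sum_sub_distrib]
    refine Finset.sum_le_sum fun k hk => ?_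
    refine le_of_eq_of_le ?_ (mul_le_mul_of_nonneg_left
      (h.le_integral_stepProduct η (h1 k hk)).2 (hη (k + 1)))
    simp only [hR]
    have : (k : ℝ) ≠ 0 := by
      have := h1 k hk
      positivity
    field_simp
  have b3 := integral_mono i0 iS hle
  rw [integral_const_mul, integral_finsetSum _ iR] at b3
  simp only [integral_const_mul] at b3
  refine b3.trans ?_
  rw [inv_mul_le_iff₀ hE]
  linarith

end Risk

/-! ### Evaluation of the bound for the two step sizes. -/

section Rates

theorem sum_Icc_inv_le (n : ℕ) : ∑ k ∈ Finset.Icc 1 n, (k : ℝ)⁻¹ ≤ 1 + Real.log n := by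
  have := harmonic_le_one_add_log n
  rw [harmonic_eq_sum_Icc] at this
  push_cast at this
  exact this

/-- Lets log n absorb additive constants: 1 ≤ 2 log n and 1 + log n ≤ 3 log n. -/
theorem half_lt_log {n : ℕ} (hn : 2 ≤ n) : 1 / 2 < Real.log n := by
  have h1 := Real.log_two_gt_d9
  have h2 : Real.log 2 ≤ Real.log n := Real.log_le_log (by norm_num) (by exact_mod_cast hn)
  linarith

variable {p : ℕ} {μ : Fin p → Measure ℝ} {f : (Fin p → ℝ) → ℝ} {a : Vec p}
  {Ω : Type*} [MeasurableSpace Ω] {P : Measure Ω} {X X' : ℕ → Ω → Fin p → ℝ}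
  {U : ℕ → Ω → Finset (Fin p)} {S₁ : Ω → Vec p}

/-- As the weights sum to 1, these norms can stand in for a constant 1. -/
theorem Setting.one_le_expNorm (h : Setting μ f a P X X' U S₁) {l : ℝ} (hl : 0 ≤ l) :
    1 ≤ expNorm a l := by
  rw [← h.weight_sum]
  exact Finset.sum_le_sum fun u _ => le_mul_of_one_le_right (h.weight_nonneg u)
    (Real.one_le_rpow one_le_two (by positivity))

theorem Setting.integral_bregman_nonneg (h : Setting μ f a P X X' U S₁) :
    0 ≤ ∫ ω, bregman (sobolIndex μ f) (S₁ ω) ∂P :=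
  integral_nonneg fun ω => bregman_nonneg h.sobolIndex_mem (h.init_mem ω)

/-- The step at k = n is zero, so the steps sum to (n − 1)c, and (n − 1)/n ≥ 1/2. The 32 is half of
64, since the regret is divided by twice the sum of the steps. -/
theorem Setting.riskBound_constStep (h : Setting μ f a P X X' U S₁) {n : ℕ} (hn : 2 ≤ n) :
    RiskBound μ f a P (cesaro (constStep a n) (iterate f X X' U (constStep a n) S₁) n)
      (√(1 + √(expNorm a 2)) *
          ((∫ ω, bregman (sobolIndex μ f) (S₁ ω) ∂P) + 32 * fourthMoment μ f) * (1 / √n)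
        + 5 * expNorm a (1 / 2) * varY μ f * (Real.log n / n)) := by
  obtain ⟨m, rfl⟩ := Nat.exists_eq_add_of_le' (show 1 ≤ n by omega)
  have hm : 1 ≤ m := by omega
  have hm' : (1 : ℝ) ≤ m := by exact_mod_cast hm
  have hL := half_lt_log hn
  have hN := h.one_le_expNorm (l := 1 / 2) (by norm_num)
  have hK := h.integral_bregman_nonneg
  have hF := fourthMoment_nonneg μ f
  have hV := h.varY_pos
  have hη : ∀ k ∈ Finset.Icc 1 m, constStep a (m + 1) (k + 1) =
      1 / √((1 + √(expNorm a 2)) * ((m + 1 : ℕ) : ℝ)) := fun k hk => by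
    rw [constStep, if_pos (by rw [Finset.mem_Icc] at hk; omega)]
  have hη0 : constStep a (m + 1) (m + 1 + 1) = 0 := if_neg (by omega)
  set A := 1 + √(expNorm a 2) with hA
  have hA1 : 1 ≤ A := by linarith [Real.sqrt_nonneg (expNorm a 2)]
  have hn0 : (0 : ℝ) < ((m + 1 : ℕ) : ℝ) := by positivity
  set c := 1 / √(A * ((m + 1 : ℕ) : ℝ)) with hc
  have hc0 : 0 < c := by positivity
  have s1 : ∑ k ∈ Finset.Icc 1 (m + 1), constStep a (m + 1) (k + 1) = m * c := by
    rw [Finset.sum_Icc_succ_top (by omega), Finset.sum_congr rfl hη, hη0]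
    simp
  have s2 : ∑ k ∈ Finset.Icc 1 (m + 1), constStep a (m + 1) (k + 1) / k ≤
      c * (1 + Real.log (m + 1 : ℕ)) := by
    rw [Finset.sum_Icc_succ_top (by omega), Finset.sum_congr rfl fun k hk => by rw [hη k hk], hη0]
    simp only [div_eq_mul_inv, ← Finset.mul_sum, zero_mul, add_zero]
    refine mul_le_mul_of_nonneg_left ((sum_Icc_inv_le m).trans ?_) hc0.le
    have : Real.log m ≤ Real.log (m + 1 : ℕ) := Real.log_le_log (by positivity) (by simp)
    linarith
  have s3 : ∑ k ∈ Finset.Icc 1 (m + 1), constStep a (m + 1) (k + 1) ^ 2 = m * c ^ 2 := by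
    rw [Finset.sum_Icc_succ_top (by omega), Finset.sum_congr rfl fun k hk => by rw [hη k hk], hη0]
    simp
  refine h.riskBound_cesaro (fun j => ?_) (by rw [s1]; positivity) ?_
  · unfold constStep; split_ifs <;> positivity
  rw [s1, s3]
  set n : ℝ := ((m + 1 : ℕ) : ℝ) with hndef
  set L := Real.log n
  set K := ∫ ω, bregman (sobolIndex μ f) (S₁ ω) ∂P
  set F := fourthMoment μ f
  set V := varY μ f
  set N := expNorm a (1 / 2)
  have hnm : n = m + 1 := by rw [hndef]; push_cast; ring
  -- The factor √A of the bound cancels the one in the step size.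
  have hcA : c * √A * (1 / √n) = 1 / n := by
    rw [hc, Real.sqrt_mul (by linarith)]
    have : √A ≠ 0 := (Real.sqrt_pos.2 (by linarith)).ne'
    have h3 : √n * √n = n := Real.mul_self_sqrt hn0.le
    field_simp
    rw [sq, h3]
  have hc2 : c ^ 2 ≤ 1 / n := by
    rw [hc, div_pow, Real.sq_sqrt (by positivity), one_pow]
    exact one_div_le_one_div_of_le hn0 (by nlinarith)
  have hmn : 1 / 2 ≤ m * (1 / n) := by
    rw [mul_one_div, div_le_div_iff₀ (by norm_num) hn0]; linarith
  have t1 : K ≤ 2 * (m * (1 / n)) * K := by nlinarith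
  have t2 : 64 * F * (m * c ^ 2) ≤ 64 * F * (m * (1 / n)) := by gcongr
  -- The factor c occurs on both sides, so centring contributes only at order log n / n. It remains
  -- to use (1 + L)/4 ≤ 5L, N ≥ 1 and 2m/n ≥ 1.
  have t3 : V / 4 * (c * (1 + L)) ≤ 2 * (m * (1 / n)) * c * (5 * N * V * L) := by
    have e1 : V / 4 * (c * (1 + L)) ≤ c * (5 * V * L) := by
      have : 0 ≤ c * V * (5 * L - (1 + L) / 4) := by
        have : 0 ≤ 5 * L - (1 + L) / 4 := by linarith
        positivity
      linarith
    have hL0 : 0 < L := by linarith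
    have e2 : c * (5 * V * L) ≤ c * (5 * N * V * L) := by
      have : 0 ≤ c * (5 * V * L) * (N - 1) := mul_nonneg (by positivity) (by linarith)
      linarith
    have e3 : c * (5 * N * V * L) ≤ 2 * (m * (1 / n)) * (c * (5 * N * V * L)) :=
      le_mul_of_one_le_left (by positivity) (by linarith)
    linarith
  have t4 := mul_le_mul_of_nonneg_left s2 (by positivity : 0 ≤ V / 4)
  have e : 2 * (m * c) * (√A * (K + 32 * F) * (1 / √n) + 5 * N * V * (L / n)) =
      2 * m * (c * √A * (1 / √n)) * (K + 32 * F) +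
        2 * (m * (1 / n)) * c * (5 * N * V * L) := by ring
  rw [e, hcA]
  linarith

theorem decrStep_eq (η₀ : ℝ) (j : ℕ) : decrStep η₀ j = η₀ / √j := by
  rw [decrStep, Real.rpow_neg (Nat.cast_nonneg j), ← Real.sqrt_eq_rpow, div_eq_mul_inv]

/-- The steps sum to at least η₀√n/2, while both error sums are at most harmonic. In the constant, 2
comes from 1 ≤ 2 log n, η₀ from the centring, and 192 = 64 · 3 from the squared residuals. -/
theorem Setting.riskBound_decrStep (h : Setting μ f a P X X' U S₁) {η₀ : ℝ} (hη₀ : 0 < η₀)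
    {n : ℕ} (hn : 2 ≤ n) :
    RiskBound μ f a P (cesaro (decrStep η₀) (iterate f X X' U (decrStep η₀) S₁) n)
      ((2 + η₀ + 192 * η₀ ^ 2) / η₀ *
        ((∫ ω, bregman (sobolIndex μ f) (S₁ ω) ∂P) + expNorm a 2 + fourthMoment μ f) *
          (Real.log n / √n)) := by
  have hL := half_lt_log hn
  have hN := h.one_le_expNorm (l := 2) (by norm_num)
  have hK := h.integral_bregman_nonneg
  have hF := fourthMoment_nonneg μ f
  have hV := h.varY_le
  have hV0 := h.varY_pos
  have hn2 : (2 : ℝ) ≤ n := by exact_mod_cast hn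
  have s1 : η₀ * √n / 2 ≤ ∑ k ∈ Finset.Icc 1 n, decrStep η₀ (k + 1) := by
    have hk : ∀ k ∈ Finset.Icc 1 n, η₀ / (2 * √n) ≤ decrStep η₀ (k + 1) := fun k hk => by
      rw [decrStep_eq]
      refine div_le_div_of_nonneg_left hη₀.le (Real.sqrt_pos.2 (by positivity)) ?_
      rw [Real.sqrt_le_left (by positivity), mul_pow, Real.sq_sqrt (by positivity)]
      have : (k : ℝ) ≤ n := by exact_mod_cast (Finset.mem_Icc.1 hk).2
      push_cast
      linarith
    have := Finset.card_nsmul_le_sum _ _ _ hk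
    refine le_trans (le_of_eq ?_) this
    have h3 : √n * √n = (n : ℝ) := Real.mul_self_sqrt (by positivity)
    have h4 : √(n : ℝ) ≠ 0 := (Real.sqrt_pos.2 (by linarith)).ne'
    simp only [Nat.card_Icc, Nat.add_sub_cancel, nsmul_eq_mul]
    field_simp
    rw [sq, h3]
  have s2 : ∑ k ∈ Finset.Icc 1 n, decrStep η₀ (k + 1) / k ≤ η₀ * (1 + Real.log n) := by
    refine le_trans ?_ (mul_le_mul_of_nonneg_left (sum_Icc_inv_le n) hη₀.le)
    rw [Finset.mul_sum]
    refine Finset.sum_le_sum fun k _ => ?_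
    rw [div_eq_mul_inv, decrStep_eq]
    refine mul_le_mul_of_nonneg_right (div_le_self hη₀.le ?_) (by positivity)
    rw [Real.one_le_sqrt]
    push_cast
    linarith [Nat.cast_nonneg (α := ℝ) k]
  have s3 : ∑ k ∈ Finset.Icc 1 n, decrStep η₀ (k + 1) ^ 2 ≤ η₀ ^ 2 * (1 + Real.log n) := by
    refine le_trans ?_ (mul_le_mul_of_nonneg_left (sum_Icc_inv_le n) (sq_nonneg η₀))
    rw [Finset.mul_sum]
    refine Finset.sum_le_sum fun k hk => ?_
    have hk0 : (0 : ℝ) < k := by exact_mod_cast (Finset.mem_Icc.1 hk).1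
    rw [decrStep_eq, div_pow, Real.sq_sqrt (by positivity), ← div_eq_mul_inv]
    exact div_le_div_of_nonneg_left (sq_nonneg _) hk0 (by push_cast; linarith)
  have hsn : 0 < √(n : ℝ) := Real.sqrt_pos.2 (by linarith)
  refine h.riskBound_cesaro (fun j => ?_) (lt_of_lt_of_le (by positivity) s1) ?_
  · rw [decrStep_eq]; positivity
  set E := ∑ k ∈ Finset.Icc 1 n, decrStep η₀ (k + 1)
  set L := Real.log n
  set K := ∫ ω, bregman (sobolIndex μ f) (S₁ ω) ∂P
  set F := fourthMoment μ f
  set V := varY μ f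
  set N := expNorm a 2
  have hL0 : 0 < L := by linarith
  have t2 := mul_le_mul_of_nonneg_left s2 (by positivity : 0 ≤ V / 4)
  have t3 := mul_le_mul_of_nonneg_left s3 (by positivity : 0 ≤ 64 * F)
  have u1 : K ≤ 2 * L * K := by nlinarith
  have u2 : V / 4 * (η₀ * (1 + L)) ≤ η₀ * L * (N + F) := by
    have e1 : V / 4 * (η₀ * (1 + L)) ≤ V / 4 * (η₀ * (4 * L)) := by gcongr; linarith
    -- Here V ≤ 1 + F ≤ N + F: the norm of a replaces the constant 1.
    have e2 : η₀ * L * V ≤ η₀ * L * (N + F) := by gcongr; linarith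
    linarith
  have u3 : 64 * F * (η₀ ^ 2 * (1 + L)) ≤ 192 * η₀ ^ 2 * L * F := by
    have : 64 * F * (η₀ ^ 2 * (1 + L)) ≤ 64 * F * (η₀ ^ 2 * (3 * L)) := by gcongr; linarith
    linarith
  have u4 : 2 * L * K + η₀ * L * (N + F) + 192 * η₀ ^ 2 * L * F ≤
      (2 + η₀ + 192 * η₀ ^ 2) * (K + N + F) * L := by
    have : 0 ≤ 2 * L * (N + F) + η₀ * L * K + 192 * η₀ ^ 2 * L * (K + N) := by positivity
    linarith
  have u5 : (2 + η₀ + 192 * η₀ ^ 2) * (K + N + F) * L = 2 * (η₀ * √n / 2) *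
      ((2 + η₀ + 192 * η₀ ^ 2) / η₀ * (K + N + F) * (L / √n)) := by
    field_simp
  have u6 : 2 * (η₀ * √n / 2) *
      ((2 + η₀ + 192 * η₀ ^ 2) / η₀ * (K + N + F) * (L / √n)) ≤ 2 * E *
      ((2 + η₀ + 192 * η₀ ^ 2) / η₀ * (K + N + F) * (L / √n)) := by
    gcongr
  linarith

end Rates

end PickFreeze

theorem theorem3p3 :
    -- constant, horizon-dependent step size
    (∃ C : ℝ, 0 < C ∧
      ∀ (p : ℕ) (μ : Fin p → Measure ℝ) (f : (Fin p → ℝ) → ℝ) (a : Vec p)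
        (Ω : Type*) [MeasurableSpace Ω] (P : Measure Ω) (X X' : ℕ → Ω → Fin p → ℝ)
        (U : ℕ → Ω → Finset (Fin p)) (S₁ : Ω → Vec p),
        Setting μ f a P X X' U S₁ → ∀ n : ℕ, 2 ≤ n →
          RiskBound μ f a P
            (cesaro (constStep a n) (iterate f X X' U (constStep a n) S₁) n)
            (√(1 + √(expNorm a 2)) *
                ((∫ ω, bregman (sobolIndex μ f) (S₁ ω) ∂P) + C * fourthMoment μ f) * (1 / √n)
              + 5 * expNorm a (1 / 2) * varY μ f * (Real.log n / n))) ∧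
    -- decreasing step size
    (∀ η₀ : ℝ, 0 < η₀ → ∃ C : ℝ, 0 < C ∧
      ∀ (p : ℕ) (μ : Fin p → Measure ℝ) (f : (Fin p → ℝ) → ℝ) (a : Vec p)
        (Ω : Type*) [MeasurableSpace Ω] (P : Measure Ω) (X X' : ℕ → Ω → Fin p → ℝ)
        (U : ℕ → Ω → Finset (Fin p)) (S₁ : Ω → Vec p),
        Setting μ f a P X X' U S₁ → ∀ n : ℕ, 2 ≤ n →
          RiskBound μ f a P
            (cesaro (decrStep η₀) (iterate f X X' U (decrStep η₀) S₁) n)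
            (C * ((∫ ω, bregman (sobolIndex μ f) (S₁ ω) ∂P) + expNorm a 2 + fourthMoment μ f)
              * (Real.log n / √n))) := by
  refine ⟨⟨32, by norm_num, ?_⟩, fun η₀ hη₀ => ⟨(2 + η₀ + 192 * η₀ ^ 2) / η₀, by positivity, ?_⟩⟩
  · intro p μ f a Ω _ P X X' U S₁ h n hn
    exact h.riskBound_constStep hn
  · intro p μ f a Ω _ P X X' U S₁ h n hn
    exact h.riskBound_decrStep hη₀ hn
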